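/- Corollary 4.1. Let $M$ be a smooth manifold of dimension $n \ge 2$, let $\alpha = \sqrt{a_{ij}(x)y^iy^j}$ be a smooth (positive definite) Riemannian metric on $M$ and let $\beta = b_i(x)y^i$ be a smooth nowhere vanishing $1$-form on $M$. Let $F = \alpha^2/\beta$ be the corresponding Kropina metric, defined on the domain $\{(x,y) \in TM : \beta(x,y) > 0\}$. In local coordinates put $g_{ij} = \tfrac12 [F^2]_{y^iy^j}$, $(g^{ij}) = (g_{ij})^{-1}$, $$G^i = \tfrac14 g^{il}\{[F^2]_{x^ky^l}y^k - [F^2]_{x^l}\},$$ $$R^i{}_k = 2\frac{\partial G^i}{\partial x^k} - \frac{\partial^2 G^i}{\partial x^m\partial y^k}y^m + 2G^m\frac{\partial^2 G^i}{\partial y^m\partial y^k} - \frac{\partial G^i}{\partial y^m}\frac{\partial G^m}{\partial y^k}, \qquad \mathrm{Ric} = R^m{}_m .$$ Suppose that $F$ is non-Riemannian (that is, there is no Riemannian metric on $M$ whose norm coincides with $F$ on the whole domain $\beta > 0$). If $F$ is Ricci-flat, that is $\mathrm{Ric} = 0$ on the domain $\beta > 0$, then $F$ is a Berwald metric: in every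 local coordinate system there are functions $\Gamma^i_{jk}(x)$ with $G^i(x,y) = \tfrac12\Gamma^i_{jk}(x)y^jy^k$ for all $(x,y)$ with $\beta(x,y) > 0$. -/

import Mathlib

open scoped Manifold ContDiff

noncomputable section

/-! ### Finsler functions in local coordinates

A function `F x y` of the position coordinates `x = (x^i)` and of the fibre coordinates `y = (y^i)`
of a tangent vector is a function `F : CoordFun n`. All the expressions below are
only ever used at points of an open set of pairs `(x, y)` on which `F` is smooth. -/

/-- Real functions of `(x, y)`, with `x` and `y` in `ℝⁿ`. -/
abbrev CoordFun (n : ℕ) : Type :=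
  EuclideanSpace ℝ (Fin n) → EuclideanSpace ℝ (Fin n) → ℝ

namespace CoordFun

variable {n : ℕ}

/-- The partial derivative `∂f/∂x^k`. -/
def dx (k : Fin n) (f : CoordFun n) : CoordFun n := fun x y =>
  fderiv ℝ (fun x' => f x' y) x (EuclideanSpace.single k 1)

/-- The partial derivative `∂f/∂y^k`. -/
def dy (k : Fin n) (f : CoordFun n) : CoordFun n := fun x y =>
  fderiv ℝ (fun y' => f x y') y (EuclideanSpace.single k 1)

/-- The square `F²`. -/
def square (F : CoordFun n) : CoordFun n := fun x y => F x y ^ 2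

/-- The fundamental tensor `g_ij = ½ [F²]_{y^i y^j}`. -/
def fundamentalTensor (F : CoordFun n) (x y : EuclideanSpace ℝ (Fin n)) :
    Matrix (Fin n) (Fin n) ℝ :=
  Matrix.of fun i j => (1 / 2 : ℝ) * dy j (dy i (square F)) x y

/-- The geodesic coefficients `G^i = ¼ g^{il} ([F²]_{x^k y^l} y^k - [F²]_{x^l})`. -/
def geodesicCoeff (F : CoordFun n) (i : Fin n) : CoordFun n := fun x y =>
  (1 / 4 : ℝ) * ∑ l, (fundamentalTensor F x y)⁻¹ i l *
    ((∑ k, dy l (dx k (square F)) x y * y k) - dx l (square F) x y)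

/-- The Riemann curvature
`R^i_k = 2 ∂G^i/∂x^k - y^m ∂²G^i/∂x^m∂y^k + 2 G^m ∂²G^i/∂y^m∂y^k - ∂G^i/∂y^m ∂G^m/∂y^k`. -/
def riemannCurvature (F : CoordFun n) (i k : Fin n) : CoordFun n := fun x y =>
  2 * dx k (geodesicCoeff F i) x y
    - (∑ m, dx m (dy k (geodesicCoeff F i)) x y * y m)
    + 2 * (∑ m, geodesicCoeff F m x y * dy m (dy k (geodesicCoeff F i)) x y)
    - ∑ m, dy m (geodesicCoeff F i) x y * dy k (geodesicCoeff F m) x y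

/-- The Ricci curvature `Ric = R^m_m`. -/
def ricciCurvature (F : CoordFun n) : CoordFun n := fun x y =>
  ∑ m, riemannCurvature F m m x y

end CoordFun

/-- The data of a Kropina metric `F = α²/β` on the smooth `n`-manifold `M`: a smooth Riemannian
metric `α² = a_ij(x) y^i y^j` and a smooth nowhere vanishing one-form `β = b_i(x) y^i`. -/
structure KropinaMetric (n : ℕ) (M : Type*) [TopologicalSpace M]
    [ChartedSpace (EuclideanSpace ℝ (Fin n)) M] [IsManifold (𝓡 n) ∞ M] where
  /-- the Riemannian metric `a_ij` -/
  a : Bundle.ContMDiffRiemannianMetric (𝓡 n) ∞ (EuclideanSpace ℝ (Fin n))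
    (fun x : M => TangentSpace (𝓡 n) x)
  /-- the one-form `β` -/
  β : ∀ x : M, TangentSpace (𝓡 n) x →L[ℝ] ℝ
  /-- `β` is smooth, as a section of the bundle of continuous linear forms on the tangent spaces -/
  contMDiff_β : ContMDiff (𝓡 n) ((𝓡 n).prod 𝓘(ℝ, EuclideanSpace ℝ (Fin n) →L[ℝ] ℝ)) ∞
    (fun x : M => Bundle.TotalSpace.mk' (EuclideanSpace ℝ (Fin n) →L[ℝ] ℝ)
      (E := fun x : M => TangentSpace (𝓡 n) x →L[ℝ] Bundle.Trivial M ℝ x) x (β x))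
  /-- `β` vanishes nowhere, so that the domain `β > 0` of `F` meets every tangent space -/
  β_ne_zero : ∀ x : M, β x ≠ 0

namespace KropinaMetric

variable {n : ℕ} {M : Type*} [TopologicalSpace M]
  [ChartedSpace (EuclideanSpace ℝ (Fin n)) M] [IsManifold (𝓡 n) ∞ M]

/-- The domain of `F` in the tangent space at `x`: the open half-space `β > 0`. -/
def domain (K : KropinaMetric n M) (x : M) : Set (TangentSpace (𝓡 n) x) :=
  {y | 0 < K.β x y}

/-- The Finsler function `F = α²/β`; it is meant on `K.domain x` only. -/
def F (K : KropinaMetric n M) (x : M) (y : TangentSpace (𝓡 n) x) : ℝ :=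
  K.a.inner x y y / K.β x y

/-- `F` is Riemannian: on its domain it is the norm of a Riemannian metric. -/
def IsRiemannian (K : KropinaMetric n M) : Prop :=
  ∃ g : Bundle.ContMDiffRiemannianMetric (𝓡 n) ∞ (EuclideanSpace ℝ (Fin n))
      (fun x : M => TangentSpace (𝓡 n) x),
    ∀ x : M, ∀ y ∈ K.domain x, K.F x y ^ 2 = g.inner x y y

/-- The tangent vector `y^i ∂/∂x^i` at the point of `M` with coordinates `x` in the chart `e`. -/
def tangentVec (e : OpenPartialHomeomorph M (EuclideanSpace ℝ (Fin n)))
    (x y : EuclideanSpace ℝ (Fin n)) : TangentSpace (𝓡 n) (e.symm x) :=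
  mfderiv (𝓡 n) (𝓡 n) e.symm x y

/-- The expression of `F` in the coordinates `(x^i, y^i)` induced by the chart `e`. -/
def inChart (K : KropinaMetric n M) (e : OpenPartialHomeomorph M (EuclideanSpace ℝ (Fin n))) :
    CoordFun n := fun x y => K.F (e.symm x) (tangentVec e x y)

/-- The coordinates `(x^i, y^i)` in the chart `e` of the tangent vectors in the domain of `F`. -/
def chartDomain (K : KropinaMetric n M) (e : OpenPartialHomeomorph M (EuclideanSpace ℝ (Fin n))) :
    Set (EuclideanSpace ℝ (Fin n) × EuclideanSpace ℝ (Fin n)) :=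
  {p | p.1 ∈ e.target ∧ tangentVec e p.1 p.2 ∈ K.domain (e.symm p.1)}

/-- `F` is an Einstein metric with Einstein scalar `σ`: `Ric = σ(x) F²` on the domain of `F`,
in all local coordinates. -/
def IsEinsteinWith (K : KropinaMetric n M) (σ : M → ℝ) : Prop :=
  ∀ e ∈ IsManifold.maximalAtlas (𝓡 n) ∞ M, ∀ x y, (x, y) ∈ K.chartDomain e →
    (K.inChart e).ricciCurvature x y = σ (e.symm x) * K.inChart e x y ^ 2

/-- `F` is Ricci-flat: it is Einstein with Einstein scalar `0`. -/
def IsRicciFlat (K : KropinaMetric n M) : Prop :=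
  K.IsEinsteinWith fun _ => 0

/-- `F` is a Berwald metric: in all local coordinates the geodesic coefficients are quadratic in
`y`, that is `G^i = ½ Γ^i_jk(x) y^j y^k` on the domain of `F`. -/
def IsBerwald (K : KropinaMetric n M) : Prop :=
  ∀ e ∈ IsManifold.maximalAtlas (𝓡 n) ∞ M,
    ∃ Γ : Fin n → Fin n → Fin n → EuclideanSpace ℝ (Fin n) → ℝ,
      ∀ x y, (x, y) ∈ K.chartDomain e → ∀ i,
        (K.inChart e).geodesicCoeff i x y = (1 / 2 : ℝ) * ∑ j, ∑ k, Γ i j k x * y j * y k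

end KropinaMetric

end

noncomputable section

/-! ### Partial derivatives -/

/-! Multiplying the metric and the one-form by the same positive function of `x` leaves `α²/β`
unchanged, so in each chart the one-form `b` may be given length one (`UnitForm.normalize`). Write
`L = α²`, let `r` and `s` be the symmetric and skew parts of the covariant derivative of `b`, and
let `B` be the dual vector field. Unit length gives `b^j b_{j|k} = 0`.

The geodesic coefficients are `Ghat + P y` (`geodesicCoeff_eq`). Here `Ghat` is polynomial in `y`
and `1/β`, and `P = -r00 β / L - s0` contains the only pole along `L = 0`. A projective change adds
`(n-1)(P² - S(P))` to the Ricci curvature, where `S` is the derivation along the spray `Ghat`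
(`sprayRicci_projective`). Since `S(L) = -2 L s0 - 2 β r00`, both `P²` and `S(P)` contribute to the
double pole, and `L² Ric = 3(n-1) β² r00² + L N` with `N` polynomial in `y` and `1/β`
(`exists_sprayRicci_eq`).

If `Ric = 0`, restrict this to a line `t B + v` with `v` nonzero and orthogonal to `B`. There `β =
t`, `L = t² + L(v)` has no real root, and `r00` is affine in `t` because `r00(B) = 0`. So `t² +
L(v)` divides a power of `t` times the square of a real affine function. Evaluation at the root `i
√L(v)` kills that function, whence `r00 = 0` (`r00_eq_zero`).

Now `b` is Killing, `s0 = 0`, and the spray is that of `a` minus `(L / 2β) σ`. Its Ricci curvature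
has a double pole along `β = 0` with coefficient `-(1/4) L² tr(su²)`
(`exists_sprayRicci_eq_of_killing`). Letting `t` tend to `0` on the same lines gives `tr(su²) = 0`.
As `su` is a positive definite matrix times a skew one, this forces `s = 0`
(`Matrix.PosDef.eq_zero_of_trace_skew`). The spray is then the Levi-Civita spray of the normalized
metric, which is quadratic in `y`. -/

/-- `φ` is differentiable at `z` and `∂φ/∂z^k = d`. -/
def HasPartial {n : ℕ} (k : Fin n) (φ : EuclideanSpace ℝ (Fin n) → ℝ)
    (z : EuclideanSpace ℝ (Fin n)) (d : ℝ) : Prop :=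
  DifferentiableAt ℝ φ z ∧ fderiv ℝ φ z (EuclideanSpace.single k 1) = d

namespace HasPartial

variable {n : ℕ} {k : Fin n} {φ ψ : EuclideanSpace ℝ (Fin n) → ℝ} {z : EuclideanSpace ℝ (Fin n)}
  {d d' : ℝ}

theorem congr_val (h : HasPartial k φ z d) (e : d = d') : HasPartial k φ z d' := e ▸ h

theorem congr_of_eventuallyEq (h : HasPartial k φ z d) (e : ψ =ᶠ[nhds z] φ) :
    HasPartial k ψ z d :=
  ⟨h.1.congr_of_eventuallyEq e, by rw [e.fderiv_eq]; exact h.2⟩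

theorem const (c : ℝ) : HasPartial k (fun _ => c) z 0 :=
  ⟨differentiableAt_const _, by simp⟩

theorem coord (i : Fin n) :
    HasPartial k (fun y : EuclideanSpace ℝ (Fin n) => y i) z (if i = k then 1 else 0) := by
  have h : HasFDerivAt (fun y : EuclideanSpace ℝ (Fin n) => y i)
      (EuclideanSpace.proj i : EuclideanSpace ℝ (Fin n) →L[ℝ] ℝ) z :=
    (EuclideanSpace.proj i : EuclideanSpace ℝ (Fin n) →L[ℝ] ℝ).hasFDerivAt
  refine ⟨h.differentiableAt, ?_⟩
  rw [h.fderiv]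
  simp

theorem add (h : HasPartial k φ z d) (h' : HasPartial k ψ z d') :
    HasPartial k (fun x => φ x + ψ x) z (d + d') :=
  ⟨h.1.add h'.1, by rw [fderiv_fun_add h.1 h'.1, ← h.2, ← h'.2]; rfl⟩

theorem sub (h : HasPartial k φ z d) (h' : HasPartial k ψ z d') :
    HasPartial k (fun x => φ x - ψ x) z (d - d') :=
  ⟨h.1.sub h'.1, by rw [fderiv_fun_sub h.1 h'.1, ← h.2, ← h'.2]; rfl⟩

theorem neg (h : HasPartial k φ z d) : HasPartial k (fun x => - φ x) z (-d) :=
  ⟨h.1.neg, by rw [fderiv_fun_neg, ← h.2]; rfl⟩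

theorem mul (h : HasPartial k φ z d) (h' : HasPartial k ψ z d') :
    HasPartial k (fun x => φ x * ψ x) z (d * ψ z + φ z * d') :=
  ⟨h.1.mul h'.1, by rw [fderiv_fun_mul h.1 h'.1, ← h.2, ← h'.2]; simp; ring⟩

theorem const_mul (c : ℝ) (h : HasPartial k φ z d) : HasPartial k (fun x => c * φ x) z (c * d) :=
  ((const c).mul h).congr_val (by ring)

theorem mul_const (h : HasPartial k φ z d) (c : ℝ) : HasPartial k (fun x => φ x * c) z (d * c) :=
  (h.mul (const c)).congr_val (by ring)

theorem inv (h : HasPartial k φ z d) (h0 : φ z ≠ 0) :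
    HasPartial k (fun x => (φ x)⁻¹) z (-d / φ z ^ 2) := by
  have := (hasDerivAt_inv h0).comp_hasFDerivAt z h.1.hasFDerivAt
  refine ⟨this.differentiableAt, ?_⟩
  have e : (fun x => (φ x)⁻¹) = Inv.inv ∘ φ := rfl
  rw [e, this.fderiv, ← h.2]
  simp; ring

theorem div (h : HasPartial k φ z d) (h' : HasPartial k ψ z d') (h0 : ψ z ≠ 0) :
    HasPartial k (fun x => φ x / ψ x) z ((d * ψ z - φ z * d') / ψ z ^ 2) := by
  simp only [div_eq_mul_inv]
  refine (h.mul (h'.inv h0)).congr_val ?_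
  field_simp
  ring

theorem sum {ι : Type*} {s : Finset ι} {f : ι → EuclideanSpace ℝ (Fin n) → ℝ} {f' : ι → ℝ}
    (h : ∀ i ∈ s, HasPartial k (f i) z (f' i)) :
    HasPartial k (fun x => ∑ i ∈ s, f i x) z (∑ i ∈ s, f' i) := by
  refine ⟨DifferentiableAt.fun_sum fun i hi => (h i hi).1, ?_⟩
  rw [fderiv_fun_sum fun i hi => (h i hi).1]
  simp only [sum_apply]
  exact Finset.sum_congr rfl fun i hi => (h i hi).2

end HasPartial

theorem DifferentiableAt.hasPartial {n : ℕ} {φ : EuclideanSpace ℝ (Fin n) → ℝ}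
    {z : EuclideanSpace ℝ (Fin n)} (h : DifferentiableAt ℝ φ z) (k : Fin n) :
    HasPartial k φ z (fderiv ℝ φ z (EuclideanSpace.single k 1)) := ⟨h, rfl⟩

/-- The derivative in the direction of `v` is the sum of the partial derivatives. -/
theorem fderiv_apply_eq_sum {n : ℕ} (φ : EuclideanSpace ℝ (Fin n) → ℝ)
    (z v : EuclideanSpace ℝ (Fin n)) :
    fderiv ℝ φ z v = ∑ k, fderiv ℝ φ z (EuclideanSpace.single k 1) * v k := by
  have : v = ∑ k, v k • (EuclideanSpace.single k (1 : ℝ) : EuclideanSpace ℝ (Fin n)) := by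
    ext i
    simp [Finset.sum_apply, Pi.single_apply]
  conv_lhs => rw [this]
  rw [map_sum]
  simp [mul_comm]

/-! ### Smooth functions of position and velocity. -/

namespace CoordFun

variable {n : ℕ} {D : Set (EuclideanSpace ℝ (Fin n) × EuclideanSpace ℝ (Fin n))}
  {f g : CoordFun n} {x y : EuclideanSpace ℝ (Fin n)}

/-- `f` is smooth on the set `D` of pairs `(x, y)`. -/
def SmoothOn (D : Set (EuclideanSpace ℝ (Fin n) × EuclideanSpace ℝ (Fin n)))
    (f : CoordFun n) : Prop :=
  ContDiffOn ℝ ∞ (fun p : EuclideanSpace ℝ (Fin n) × EuclideanSpace ℝ (Fin n) => f p.1 p.2) D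

theorem SmoothOn.congr (hf : SmoothOn D f) (h : ∀ x y, (x, y) ∈ D → g x y = f x y) :
    SmoothOn D g :=
  ContDiffOn.congr hf fun p hp => h p.1 p.2 hp

theorem SmoothOn.mono {D' : Set (EuclideanSpace ℝ (Fin n) × EuclideanSpace ℝ (Fin n))}
    (hf : SmoothOn D f) (h : D' ⊆ D) : SmoothOn D' f := ContDiffOn.mono hf h

theorem SmoothOn.differentiableAt (hf : SmoothOn D f) (hD : IsOpen D) (hp : (x, y) ∈ D) :
    DifferentiableAt ℝ (fun p : EuclideanSpace ℝ (Fin n) × EuclideanSpace ℝ (Fin n) => f p.1 p.2)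
      (x, y) :=
  (ContDiffOn.contDiffAt hf (hD.mem_nhds hp)).differentiableAt (by simp)

theorem SmoothOn.hasFDerivAt_left (hf : SmoothOn D f) (hD : IsOpen D) (hp : (x, y) ∈ D) :
    HasFDerivAt (fun x' => f x' y) ((fderiv ℝ (fun p : EuclideanSpace ℝ (Fin n) ×
      EuclideanSpace ℝ (Fin n) => f p.1 p.2) (x, y)).comp
        (ContinuousLinearMap.inl ℝ _ _)) x :=
  HasFDerivAt.comp x (f := fun x' => (x', y)) (hf.differentiableAt hD hp).hasFDerivAt
    (hasFDerivAt_prodMk_left x y)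

theorem SmoothOn.hasFDerivAt_right (hf : SmoothOn D f) (hD : IsOpen D) (hp : (x, y) ∈ D) :
    HasFDerivAt (fun y' => f x y') ((fderiv ℝ (fun p : EuclideanSpace ℝ (Fin n) ×
      EuclideanSpace ℝ (Fin n) => f p.1 p.2) (x, y)).comp
        (ContinuousLinearMap.inr ℝ _ _)) y :=
  HasFDerivAt.comp y (f := fun y' => (x, y')) (hf.differentiableAt hD hp).hasFDerivAt
    (hasFDerivAt_prodMk_right x y)

theorem SmoothOn.hasPartial_left (hf : SmoothOn D f) (hD : IsOpen D) (hp : (x, y) ∈ D)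
    (k : Fin n) : HasPartial k (fun x' => f x' y) x (dx k f x y) :=
  ⟨(hf.hasFDerivAt_left hD hp).differentiableAt, rfl⟩

theorem SmoothOn.hasPartial_right (hf : SmoothOn D f) (hD : IsOpen D) (hp : (x, y) ∈ D)
    (k : Fin n) : HasPartial k (fun y' => f x y') y (dy k f x y) :=
  ⟨(hf.hasFDerivAt_right hD hp).differentiableAt, rfl⟩

/-- On an open set the partial derivative is the total derivative on the product applied to the
constant vector `(e_k, 0)`. -/
theorem SmoothOn.dx (hf : SmoothOn D f) (hD : IsOpen D) (k : Fin n) : SmoothOn D (dx k f) := by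
  have h : ContDiffOn ℝ ∞ (fun p => fderiv ℝ (fun p : EuclideanSpace ℝ (Fin n) ×
      EuclideanSpace ℝ (Fin n) => f p.1 p.2) p (EuclideanSpace.single k 1, 0)) D :=
    (ContDiffOn.fderiv_of_isOpen hf hD (by simp)).clm_apply contDiffOn_const
  refine ContDiffOn.congr h fun p hp => ?_
  simp only [CoordFun.dx]
  rw [(hf.hasFDerivAt_left hD hp).fderiv]
  rfl

theorem SmoothOn.dy (hf : SmoothOn D f) (hD : IsOpen D) (k : Fin n) : SmoothOn D (dy k f) := by
  have h : ContDiffOn ℝ ∞ (fun p => fderiv ℝ (fun p : EuclideanSpace ℝ (Fin n) ×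
      EuclideanSpace ℝ (Fin n) => f p.1 p.2) p (0, EuclideanSpace.single k 1)) D :=
    (ContDiffOn.fderiv_of_isOpen hf hD (by simp)).clm_apply contDiffOn_const
  refine ContDiffOn.congr h fun p hp => ?_
  simp only [CoordFun.dy]
  rw [(hf.hasFDerivAt_right hD hp).fderiv]
  rfl

theorem SmoothOn.add (hf : SmoothOn D f) (hg : SmoothOn D g) :
    SmoothOn D (fun x y => f x y + g x y) := ContDiffOn.add hf hg

theorem SmoothOn.sub (hf : SmoothOn D f) (hg : SmoothOn D g) :
    SmoothOn D (fun x y => f x y - g x y) := ContDiffOn.sub hf hg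

theorem SmoothOn.mul (hf : SmoothOn D f) (hg : SmoothOn D g) :
    SmoothOn D (fun x y => f x y * g x y) := ContDiffOn.mul hf hg

theorem SmoothOn.inv (hf : SmoothOn D f) (h0 : ∀ x y, (x, y) ∈ D → f x y ≠ 0) :
    SmoothOn D (fun x y => (f x y)⁻¹) := ContDiffOn.inv hf fun p hp => h0 p.1 p.2 hp

theorem SmoothOn.div (hf : SmoothOn D f) (hg : SmoothOn D g)
    (h0 : ∀ x y, (x, y) ∈ D → g x y ≠ 0) :
    SmoothOn D (fun x y => f x y / g x y) := ContDiffOn.div hf hg fun p hp => h0 p.1 p.2 hp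

theorem SmoothOn.sum {ι : Type*} {s : Finset ι} {f : ι → CoordFun n}
    (h : ∀ i ∈ s, SmoothOn D (f i)) : SmoothOn D (fun x y => ∑ i ∈ s, f i x y) :=
  ContDiffOn.sum h

theorem smoothOn_const (c : ℝ) : SmoothOn D (fun _ _ : EuclideanSpace ℝ (Fin n) => c) :=
  contDiffOn_const

theorem smoothOn_coord (i : Fin n) : SmoothOn D (fun _ y => y i) := by
  unfold SmoothOn
  fun_prop

theorem smoothOn_coef {U : Set (EuclideanSpace ℝ (Fin n))} {c : EuclideanSpace ℝ (Fin n) → ℝ}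
    (hc : ContDiffOn ℝ ∞ c U) (hD : ∀ p ∈ D, p.1 ∈ U) : SmoothOn D (fun x _ => c x) :=
  hc.comp contDiffOn_fst hD

theorem eventuallyEq_left (hD : IsOpen D) (h : ∀ x y, (x, y) ∈ D → f x y = g x y)
    (hp : (x, y) ∈ D) : (fun x' => f x' y) =ᶠ[nhds x] fun x' => g x' y := by
  have : ∀ᶠ x' in nhds x, (x', y) ∈ D :=
    (by fun_prop : Continuous fun x' : EuclideanSpace ℝ (Fin n) => (x', y)).continuousAt
      |>.eventually (hD.mem_nhds hp)
  filter_upwards [this] with x' hx' using h x' y hx'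

theorem eventuallyEq_right (hD : IsOpen D) (h : ∀ x y, (x, y) ∈ D → f x y = g x y)
    (hp : (x, y) ∈ D) : (fun y' => f x y') =ᶠ[nhds y] fun y' => g x y' := by
  have : ∀ᶠ y' in nhds y, (x, y') ∈ D :=
    (by fun_prop : Continuous fun y' : EuclideanSpace ℝ (Fin n) => (x, y')).continuousAt
      |>.eventually (hD.mem_nhds hp)
  filter_upwards [this] with y' hy' using h x y' hy'

theorem dx_congr (hD : IsOpen D) (h : ∀ x y, (x, y) ∈ D → f x y = g x y) (k : Fin n)
    (hp : (x, y) ∈ D) : dx k f x y = dx k g x y := by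
  unfold dx
  rw [(eventuallyEq_left hD h hp).fderiv_eq]

theorem dy_congr (hD : IsOpen D) (h : ∀ x y, (x, y) ∈ D → f x y = g x y) (k : Fin n)
    (hp : (x, y) ∈ D) : dy k f x y = dy k g x y := by
  unfold dy
  rw [(eventuallyEq_right hD h hp).fderiv_eq]

/-! ### Homogeneity -/

/-- `f` is positively homogeneous of degree `d` in `y` on the conic set `D`. -/
def HomogeneousOn (D : Set (EuclideanSpace ℝ (Fin n) × EuclideanSpace ℝ (Fin n))) (d : ℕ)
    (f : CoordFun n) : Prop :=
  ∀ x y, (x, y) ∈ D → ∀ t : ℝ, 0 < t → f x (t • y) = t ^ d * f x y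

/-- Euler's theorem. -/
theorem HomogeneousOn.euler {d : ℕ} (h : HomogeneousOn D d f) (hf : SmoothOn D f) (hD : IsOpen D)
    (hp : (x, y) ∈ D) : ∑ m, dy m f x y * y m = d * f x y := by
  have h1 : HasDerivAt (fun t : ℝ => f x (t • y)) (fderiv ℝ (fun y' => f x y') y y) 1 := by
    have hl : HasDerivAt (fun t : ℝ => t • y) y 1 := by
      simpa using (hasDerivAt_id (1 : ℝ)).smul_const y
    have hd : HasFDerivAt (fun y' => f x y') (fderiv ℝ (fun y' => f x y') y) ((1 : ℝ) • y) := by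
      rw [one_smul]
      exact (hf.hasFDerivAt_right hD hp).differentiableAt.hasFDerivAt
    exact hd.comp_hasDerivAt (1 : ℝ) hl
  have h2 : HasDerivAt (fun t : ℝ => f x (t • y)) (d * f x y) 1 := by
    have h3 : HasDerivAt (fun t : ℝ => t ^ d * f x y) (d * f x y) 1 := by
      simpa using (hasDerivAt_pow d (1 : ℝ)).mul_const (f x y)
    refine h3.congr_of_eventuallyEq ?_
    filter_upwards [lt_mem_nhds (zero_lt_one' ℝ)] with t ht using h x y hp t ht
  rw [← h1.unique h2, fderiv_apply_eq_sum]
  rfl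

/-- Differentiate `f x (t • y) = t ^ (d + 1) * f x y` in `y` and cancel the factor `t` that the
chain rule produces on the left. -/
theorem HomogeneousOn.dy {d : ℕ} (h : HomogeneousOn D (d + 1) f) (hf : SmoothOn D f)
    (hD : IsOpen D) (hcone : ∀ x y, (x, y) ∈ D → ∀ t : ℝ, 0 < t → (x, t • y) ∈ D) (k : Fin n) :
    HomogeneousOn D d (dy k f) := by
  intro x y hp t ht
  have h1 : HasFDerivAt (fun y' => f x (t • y'))
      ((fderiv ℝ (fun y' => f x y') (t • y)).comp
        (t • ContinuousLinearMap.id ℝ (EuclideanSpace ℝ (Fin n)))) y :=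
    HasFDerivAt.comp y (g := fun y' => f x y') (f := fun y' => t • y')
      (hf.hasFDerivAt_right hD (hcone x y hp t ht)).differentiableAt.hasFDerivAt
      ((hasFDerivAt_id y).const_smul t)
  have h2 : HasFDerivAt (fun y' => f x (t • y'))
      (t ^ (d + 1) • fderiv ℝ (fun y' => f x y') y) y := by
    have h3 := (hf.hasFDerivAt_right hD hp).differentiableAt.hasFDerivAt.const_mul (t ^ (d + 1))
    refine h3.congr_of_eventuallyEq ?_
    exact eventuallyEq_right (f := fun x y => f x (t • y)) (g := fun x y => t ^ (d + 1) * f x y)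
      hD (fun x y hxy => h x y hxy t ht) hp
  have h3 := congrArg (fun A => A (EuclideanSpace.single k 1)) (h1.unique h2)
  simp only [ContinuousLinearMap.comp_apply, smul_apply, map_smul,
    ContinuousLinearMap.id_apply, smul_eq_mul] at h3
  unfold CoordFun.dy
  apply mul_left_cancel₀ ht.ne'
  rw [h3]
  ring

/-! ### The Ricci curvature of a spray -/

/-- The divergence `∂G^k/∂y^k`. -/
def divY (G : Fin n → CoordFun n) : CoordFun n := fun x y => ∑ k, dy k (G k) x y

/-- The Ricci curvature of the spray with coefficients `G^i`. -/
def sprayRicci (G : Fin n → CoordFun n) : CoordFun n := fun x y =>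
  2 * (∑ k, dx k (G k) x y) - (∑ m, dx m (divY G) x y * y m)
    + 2 * (∑ m, G m x y * dy m (divY G) x y)
    - ∑ i, ∑ m, dy m (G i) x y * dy i (G m) x y

theorem SmoothOn.divY {G : Fin n → CoordFun n} (hG : ∀ i, SmoothOn D (G i)) (hD : IsOpen D) :
    SmoothOn D (divY G) := SmoothOn.sum fun k _ => (hG k).dy hD k

theorem sprayRicci_congr {G G' : Fin n → CoordFun n} (hD : IsOpen D)
    (h : ∀ i x y, (x, y) ∈ D → G i x y = G' i x y) (hp : (x, y) ∈ D) :
    sprayRicci G x y = sprayRicci G' x y := by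
  have hdiv : ∀ x y, (x, y) ∈ D → CoordFun.divY G x y = CoordFun.divY G' x y := fun x y hxy =>
    Finset.sum_congr rfl fun k _ => dy_congr hD (h k) k hxy
  unfold sprayRicci
  simp only [fun k => dx_congr hD (h k) k hp, fun m => dx_congr hD hdiv m hp,
    fun m => dy_congr hD hdiv m hp, fun i m => dy_congr hD (h i) m hp, fun m => h m x y hp]

/-- In the trace of the second-order terms the contracted derivative `∂/∂y^k` is already the inner
one, so linearity produces the divergence and no exchange of partial derivatives is needed. -/
theorem ricciCurvature_eq_sprayRicci {F : CoordFun n} (hD : IsOpen D)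
    (hG : ∀ i, SmoothOn D (geodesicCoeff F i)) (hp : (x, y) ∈ D) :
    ricciCurvature F x y = sprayRicci (geodesicCoeff F) x y := by
  have h1 : ∀ m, dx m (divY (geodesicCoeff F)) x y =
      ∑ k, dx m (dy k (geodesicCoeff F k)) x y := fun m =>
    (HasPartial.sum fun k _ => ((hG k).dy hD k).hasPartial_left hD hp m).2
  have h2 : ∀ m, dy m (divY (geodesicCoeff F)) x y =
      ∑ k, dy m (dy k (geodesicCoeff F k)) x y := fun m =>
    (HasPartial.sum fun k _ => ((hG k).dy hD k).hasPartial_right hD hp m).2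
  unfold ricciCurvature riemannCurvature sprayRicci
  simp only [h1, h2, Finset.sum_sub_distrib, Finset.sum_add_distrib, Finset.mul_sum,
    Finset.sum_mul]
  congr 2
  · congr 1
    exact Finset.sum_comm
  · exact Finset.sum_comm

/-- The change of the Ricci curvature under a projective change of the spray. -/
theorem sprayRicci_projective {G : Fin n → CoordFun n} {P : CoordFun n} (hD : IsOpen D)
    (hcone : ∀ x y, (x, y) ∈ D → ∀ t : ℝ, 0 < t → (x, t • y) ∈ D)
    (hG : ∀ i, SmoothOn D (G i)) (hP : SmoothOn D P) (hG2 : ∀ i, HomogeneousOn D 2 (G i))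
    (hP1 : HomogeneousOn D 1 P) (hp : (x, y) ∈ D) :
    sprayRicci (fun i x y => G i x y + P x y * y i) x y = sprayRicci G x y +
      (n - 1) * (P x y ^ 2 - ((∑ m, y m * dx m P x y) - 2 * ∑ m, G m x y * dy m P x y)) := by
  have hdG := SmoothOn.divY hG hD
  have eP : ∀ x y, (x, y) ∈ D → ∑ m, dy m P x y * y m = P x y := fun x y hxy => by
    simpa using hP1.euler hP hD hxy
  have eG : ∀ i, ∑ m, dy m (G i) x y * y m = 2 * G i x y := fun i => by
    simpa using (hG2 i).euler (hG i) hD hp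
  have hdG1 : HomogeneousOn D 1 (divY G) := fun x y hxy t ht => by
    simp only [divY, Finset.mul_sum]
    exact Finset.sum_congr rfl fun k _ => (hG2 k).dy (hG k) hD hcone k x y hxy t ht
  have eD : ∑ m, dy m (divY G) x y * y m = divY G x y := by
    simpa using hdG1.euler hdG hD hp
  have h1 : ∀ x y, (x, y) ∈ D → ∀ i m, dy m (fun x y => G i x y + P x y * y i) x y =
      dy m (G i) x y + (dy m P x y * y i + P x y * if i = m then 1 else 0) :=
    fun x y hxy i m => (((hG i).hasPartial_right hD hxy m).add
      ((hP.hasPartial_right hD hxy m).mul (HasPartial.coord i))).2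
  have h2 : ∀ i m, dx m (fun x y => G i x y + P x y * y i) x y =
      dx m (G i) x y + dx m P x y * y i :=
    fun i m => (((hG i).hasPartial_left hD hp m).add
      ((hP.hasPartial_left hD hp m).mul_const (y i))).2
  -- The trace of `P · id` gives `n P`, and Euler's theorem for `P` gives the remaining `P`.
  have h3 : ∀ x y, (x, y) ∈ D → divY (fun i x y => G i x y + P x y * y i) x y =
      divY G x y + (n + 1) * P x y := fun x y hxy => by
    simp only [divY, h1 x y hxy, Finset.sum_add_distrib, eP x y hxy]
    simp
    ring
  have h4 : ∀ m, dx m (divY (fun i x y => G i x y + P x y * y i)) x y =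
      dx m (divY G) x y + (n + 1) * dx m P x y := fun m => by
    rw [dx_congr hD h3 m hp]
    exact ((hdG.hasPartial_left hD hp m).add ((hP.hasPartial_left hD hp m).const_mul _)).2
  have h5 : ∀ m, dy m (divY (fun i x y => G i x y + P x y * y i)) x y =
      dy m (divY G) x y + (n + 1) * dy m P x y := fun m => by
    rw [dy_congr hD h3 m hp]
    exact ((hdG.hasPartial_right hD hp m).add ((hP.hasPartial_right hD hp m).const_mul _)).2
  -- This is the trace of the square of `dG + y ⊗ dP + P · id`. The coefficient `n + 3` of `P²` is
  -- `n` from the identity, `1` from `(y ⊗ dP)²` and `2` from their cross term.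
  have q : ∑ i, ∑ m, (dy m (G i) x y + (dy m P x y * y i + P x y * if i = m then 1 else 0)) *
      (dy i (G m) x y + (dy i P x y * y m + P x y * if m = i then 1 else 0)) =
      (∑ i, ∑ m, dy m (G i) x y * dy i (G m) x y) + 4 * (∑ m, G m x y * dy m P x y)
        + 2 * P x y * divY G x y + (n + 3) * P x y ^ 2 := by
    have c1 : ∑ i, ∑ m, dy m (G i) x y * (dy i P x y * y m) = 2 * ∑ m, G m x y * dy m P x y := by
      rw [Finset.mul_sum]
      refine Finset.sum_congr rfl fun i _ => ?_
      rw [← mul_assoc, ← eG i, Finset.sum_mul]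
      exact Finset.sum_congr rfl fun m _ => by ring
    have c2 : ∑ i, ∑ m, dy m P x y * y i * dy i (G m) x y = 2 * ∑ m, G m x y * dy m P x y := by
      rw [← c1, Finset.sum_comm]
      exact Finset.sum_congr rfl fun i _ => Finset.sum_congr rfl fun m _ => by ring
    have c3 : ∑ i, ∑ m, dy m P x y * y i * (dy i P x y * y m) = P x y ^ 2 := by
      rw [sq]
      nth_rw 1 [← eP x y hp]
      rw [← eP x y hp, Finset.sum_mul_sum]
      exact Finset.sum_congr rfl fun i _ => Finset.sum_congr rfl fun m _ => by ring
    have c4 : ∀ i m : Fin n, (if m = i then (1 : ℝ) else 0) = if i = m then 1 else 0 :=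
      fun i m => by simp only [eq_comm]
    simp only [c4, add_mul, mul_add, Finset.sum_add_distrib, c1, c2, c3]
    have c5 : ∑ i, dy i (G i) x y = divY G x y := rfl
    simp only [mul_ite, ite_mul, mul_one, mul_zero, zero_mul, Finset.sum_ite_eq,
      Finset.mem_univ, if_true, ← Finset.sum_mul, ← Finset.mul_sum, c5]
    simp only [eP x y hp]
    simp
    ring
  unfold sprayRicci
  simp only [h1 x y hp, h2, h4, h5, q]
  have t1 : ∑ m, (G m x y + P x y * y m) * (dy m (divY G) x y + (n + 1) * dy m P x y) =
      (∑ m, G m x y * dy m (divY G) x y) + (n + 1) * (∑ m, G m x y * dy m P x y)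
        + P x y * divY G x y + (n + 1) * P x y ^ 2 := by
    have : (n + 1) * P x y ^ 2 = (n + 1) * (P x y * ∑ m, dy m P x y * y m) := by
      rw [eP x y hp]; ring
    rw [this, ← eD]
    simp only [Finset.mul_sum, ← Finset.sum_add_distrib]
    exact Finset.sum_congr rfl fun m _ => by ring
  have t2 : ∑ m, (dx m (divY G) x y + (n + 1) * dx m P x y) * y m =
      (∑ m, dx m (divY G) x y * y m) + (n + 1) * ∑ m, y m * dx m P x y := by
    simp only [Finset.mul_sum, ← Finset.sum_add_distrib]
    exact Finset.sum_congr rfl fun m _ => by ring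
  have t3 : ∑ k, (dx k (G k) x y + dx k P x y * y k) =
      (∑ k, dx k (G k) x y) + ∑ m, y m * dx m P x y := by
    simp only [← Finset.sum_add_distrib]
    exact Finset.sum_congr rfl fun m _ => by ring
  rw [t1, t2, t3]
  ring

end CoordFun

/-! ### Kropina metrics in coordinates -/

/-- The partial derivative `∂c/∂x^k` of a function of the position. -/
def pd {n : ℕ} (k : Fin n) (c : EuclideanSpace ℝ (Fin n) → ℝ) : EuclideanSpace ℝ (Fin n) → ℝ :=
  fun x => fderiv ℝ c x (EuclideanSpace.single k 1)

theorem ContDiffOn.pd {n : ℕ} {U : Set (EuclideanSpace ℝ (Fin n))}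
    {c : EuclideanSpace ℝ (Fin n) → ℝ} (hc : ContDiffOn ℝ ∞ c U) (hU : IsOpen U) (k : Fin n) :
    ContDiffOn ℝ ∞ (pd k c) U :=
  (hc.fderiv_of_isOpen hU (by simp)).clm_apply contDiffOn_const

theorem ContDiffOn.hasPartial {n : ℕ} {U : Set (EuclideanSpace ℝ (Fin n))}
    {c : EuclideanSpace ℝ (Fin n) → ℝ} (hc : ContDiffOn ℝ ∞ c U) (hU : IsOpen U)
    {x : EuclideanSpace ℝ (Fin n)} (hx : x ∈ U) (k : Fin n) : HasPartial k c x (_root_.pd k c x) :=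
  ⟨(hc.contDiffAt (hU.mem_nhds hx)).differentiableAt (by simp), rfl⟩

/-- The coordinate expression, on an open set `U`, of a Riemannian metric `a` with inverse `ai`
and of a one-form `b` of constant length one. -/
structure UnitForm (n : ℕ) (U : Set (EuclideanSpace ℝ (Fin n))) where
  /-- the metric -/
  a : Fin n → Fin n → EuclideanSpace ℝ (Fin n) → ℝ
  /-- the inverse metric -/
  ai : Fin n → Fin n → EuclideanSpace ℝ (Fin n) → ℝ
  /-- the one-form -/
  b : Fin n → EuclideanSpace ℝ (Fin n) → ℝ
  isOpen : IsOpen U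
  smooth_a : ∀ i j, ContDiffOn ℝ ∞ (a i j) U
  smooth_ai : ∀ i j, ContDiffOn ℝ ∞ (ai i j) U
  smooth_b : ∀ i, ContDiffOn ℝ ∞ (b i) U
  symm_a : ∀ i j x, x ∈ U → a i j x = a j i x
  symm_ai : ∀ i j x, x ∈ U → ai i j x = ai j i x
  mul_inv : ∀ i k x, x ∈ U → ∑ j, a i j x * ai j k x = if i = k then 1 else 0
  pos : ∀ x, x ∈ U → ∀ y : EuclideanSpace ℝ (Fin n), y ≠ 0 → 0 < ∑ i, ∑ j, a i j x * y i * y j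
  unit : ∀ x, x ∈ U → ∑ i, b i x * ∑ j, ai i j x * b j x = 1

namespace UnitForm

open CoordFun

variable {n : ℕ} {U : Set (EuclideanSpace ℝ (Fin n))} (K : UnitForm n U)
  {x y : EuclideanSpace ℝ (Fin n)}

/-- The vector field dual to `b`. -/
def B (i : Fin n) : EuclideanSpace ℝ (Fin n) → ℝ := fun x => ∑ j, K.ai i j x * K.b j x

/-- `α²` -/
def L : CoordFun n := fun x y => ∑ i, ∑ j, K.a i j x * y i * y j

/-- `β` -/
def β : CoordFun n := fun x y => ∑ i, K.b i x * y i

/-- The covector `a_ij y^j`. -/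
def Y (i : Fin n) : CoordFun n := fun x y => ∑ j, K.a i j x * y j

/-- `∂α²/∂x^k` -/
def Lx (k : Fin n) : CoordFun n := fun x y => ∑ i, ∑ j, pd k (K.a i j) x * y i * y j

/-- `∂β/∂x^k` -/
def βx (k : Fin n) : CoordFun n := fun x y => ∑ i, pd k (K.b i) x * y i

/-- `∂a_ij/∂x^k y^j` -/
def Yx (k i : Fin n) : CoordFun n := fun x y => ∑ j, pd k (K.a i j) x * y j

/-- Christoffel symbols of the first kind. -/
def chr (l j k : Fin n) : EuclideanSpace ℝ (Fin n) → ℝ := fun x =>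
  1 / 2 * (pd k (K.a l j) x + pd j (K.a l k) x - pd l (K.a j k) x)

/-- Christoffel symbols of the second kind. -/
def Γ (i j k : Fin n) : EuclideanSpace ℝ (Fin n) → ℝ := fun x => ∑ l, K.ai i l x * K.chr l j k x

/-- The geodesic coefficients of `a`. -/
def Gbar (i : Fin n) : CoordFun n := fun x y => 1 / 2 * ∑ j, ∑ k, K.Γ i j k x * y j * y k

/-- The covariant derivative `b_{j|k}`. -/
def nb (j k : Fin n) : EuclideanSpace ℝ (Fin n) → ℝ := fun x =>
  pd k (K.b j) x - ∑ i, K.Γ i j k x * K.b i x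

/-- The symmetric part of the covariant derivative of `b`. -/
def r (j k : Fin n) : EuclideanSpace ℝ (Fin n) → ℝ := fun x => 1 / 2 * (K.nb j k x + K.nb k j x)

/-- The skew part of the covariant derivative of `b`. -/
def s (j k : Fin n) : EuclideanSpace ℝ (Fin n) → ℝ := fun x => 1 / 2 * (K.nb j k x - K.nb k j x)

/-- `r_jk y^j y^k` -/
def r00 : CoordFun n := fun x y => ∑ j, ∑ k, K.r j k x * y j * y k

/-- `s_ij y^j` -/
def slow (i : Fin n) : CoordFun n := fun x y => ∑ j, K.s i j x * y j

/-- `s^i_j` -/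
def su (i j : Fin n) : EuclideanSpace ℝ (Fin n) → ℝ := fun x => ∑ l, K.ai i l x * K.s l j x

/-- `s^i_j y^j` -/
def σ (i : Fin n) : CoordFun n := fun x y => ∑ l, K.ai i l x * K.slow l x y

/-- `b^i s_ij y^j` -/
def s0 : CoordFun n := fun x y => ∑ l, K.B l x * K.slow l x y

/-- The domain `β > 0`. -/
def D (K : UnitForm n U) : Set (EuclideanSpace ℝ (Fin n) × EuclideanSpace ℝ (Fin n)) :=
  {p | p.1 ∈ U ∧ 0 < K.β p.1 p.2}

/-! ### Contractions with the metric, with `y` and with `b`. -/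

theorem lower_raise (hx : x ∈ U) (v : Fin n → ℝ) (i : Fin n) :
    ∑ l, K.a i l x * ∑ m, K.ai l m x * v m = v i := by
  simp only [Finset.mul_sum]
  rw [Finset.sum_comm]
  simp only [← mul_assoc, ← Finset.sum_mul, K.mul_inv i _ x hx]
  simp

theorem sum_Y_raise (hx : x ∈ U) (v : Fin n → ℝ) :
    ∑ l, K.Y l x y * ∑ m, K.ai l m x * v m = ∑ m, y m * v m := by
  calc ∑ l, K.Y l x y * ∑ m, K.ai l m x * v m
      = ∑ i, y i * ∑ l, K.a i l x * ∑ m, K.ai l m x * v m := by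
        simp only [Y, Finset.sum_mul, Finset.mul_sum (a := y _)]
        rw [Finset.sum_comm]
        refine Finset.sum_congr rfl fun i _ => Finset.sum_congr rfl fun l _ => ?_
        rw [K.symm_a l i x hx]; ring
    _ = _ := by simp only [K.lower_raise hx]

theorem sum_b_raise (hx : x ∈ U) (v : Fin n → ℝ) :
    ∑ l, K.b l x * ∑ m, K.ai l m x * v m = ∑ m, K.B m x * v m := by
  simp only [B, Finset.sum_mul, Finset.mul_sum]
  rw [Finset.sum_comm]
  refine Finset.sum_congr rfl fun i _ => Finset.sum_congr rfl fun l _ => ?_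
  rw [K.symm_ai i l x hx]; ring

theorem sum_a_B (hx : x ∈ U) (i : Fin n) : ∑ l, K.a i l x * K.B l x = K.b i x :=
  K.lower_raise hx (fun m => K.b m x) i

theorem sum_Y_B (hx : x ∈ U) : ∑ l, K.Y l x y * K.B l x = K.β x y := by
  have := K.sum_Y_raise (y := y) hx (fun m => K.b m x)
  rw [β]
  simp only [mul_comm (K.b _ x)]
  exact this

theorem sum_b_B (hx : x ∈ U) : ∑ l, K.b l x * K.B l x = 1 := K.unit x hx

theorem sum_Y_y : ∑ l, K.Y l x y * y l = K.L x y := by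
  simp only [Y, L, Finset.sum_mul]
  exact Finset.sum_congr rfl fun i _ => Finset.sum_congr rfl fun l _ => by ring

theorem s_antisymm (i j : Fin n) (x : EuclideanSpace ℝ (Fin n)) : K.s i j x = - K.s j i x := by
  unfold s; ring

theorem sum_y_slow : ∑ l, y l * K.slow l x y = 0 := by
  have h : ∑ l, y l * K.slow l x y = - ∑ l, y l * K.slow l x y := by
    simp only [slow, Finset.mul_sum]
    conv_lhs => rw [Finset.sum_comm]
    simp only [← Finset.sum_neg_distrib]
    refine Finset.sum_congr rfl fun i _ => Finset.sum_congr rfl fun l _ => ?_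
    rw [K.s_antisymm l i]; ring
  linarith

theorem sum_Y_σ (hx : x ∈ U) : ∑ l, K.Y l x y * K.σ l x y = 0 :=
  (K.sum_Y_raise hx fun m => K.slow m x y).trans K.sum_y_slow

theorem sum_b_σ (hx : x ∈ U) : ∑ l, K.b l x * K.σ l x y = K.s0 x y :=
  K.sum_b_raise hx fun m => K.slow m x y

theorem sum_a_σ (hx : x ∈ U) (i : Fin n) : ∑ l, K.a i l x * K.σ l x y = K.slow i x y :=
  K.lower_raise hx (fun m => K.slow m x y) i

theorem pd_symm_a (hx : x ∈ U) (l j k : Fin n) : pd l (K.a j k) x = pd l (K.a k j) x := by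
  have e : K.a j k =ᶠ[nhds x] K.a k j := by
    filter_upwards [K.isOpen.mem_nhds hx] with z hz using K.symm_a j k z hz
  unfold pd
  rw [e.fderiv_eq]

theorem Γ_symm (hx : x ∈ U) (i j k : Fin n) : K.Γ i j k x = K.Γ i k j x := by
  unfold Γ chr
  refine Finset.sum_congr rfl fun l _ => ?_
  rw [K.pd_symm_a hx l j k]; ring

theorem s_eq (hx : x ∈ U) (j k : Fin n) :
    K.s j k x = 1 / 2 * (pd k (K.b j) x - pd j (K.b k) x) := by
  unfold s nb
  simp only [K.Γ_symm hx _ k j]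
  ring

theorem Gbar_eq_raise (i : Fin n) (x y : EuclideanSpace ℝ (Fin n)) : K.Gbar i x y =
    ∑ l, K.ai i l x * (1 / 2 * ∑ j, ∑ k, K.chr l j k x * y j * y k) := by
  simp only [Gbar, Γ, Finset.mul_sum, Finset.sum_mul]
  refine (Finset.sum_congr rfl fun j _ => Finset.sum_comm).trans ?_
  rw [Finset.sum_comm]
  exact Finset.sum_congr rfl fun l _ => Finset.sum_congr rfl fun j _ =>
    Finset.sum_congr rfl fun k _ => by ring

/-- The Euler-Lagrange expression of `α²`. -/
theorem euler_lagrange_L (hx : x ∈ U) (i : Fin n) :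
    2 * (∑ k, K.Yx k i x y * y k) - K.Lx i x y = 4 * ∑ l, K.a i l x * K.Gbar l x y := by
  simp only [Gbar_eq_raise]
  rw [K.lower_raise hx fun l => 1 / 2 * ∑ j, ∑ k, K.chr l j k x * y j * y k]
  have h1 : ∑ j, ∑ k, pd k (K.a i j) x * y j * y k = ∑ k, K.Yx k i x y * y k := by
    rw [Finset.sum_comm]
    simp only [Yx, Finset.sum_mul]
  have h2 : ∑ j, ∑ k, pd j (K.a i k) x * y j * y k = ∑ k, K.Yx k i x y * y k := by
    simp only [Yx, Finset.sum_mul]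
    exact Finset.sum_congr rfl fun i _ => Finset.sum_congr rfl fun l _ => by ring
  have h3 : ∑ j, ∑ k, K.chr i j k x * y j * y k = 1 / 2 *
      ((∑ j, ∑ k, pd k (K.a i j) x * y j * y k) + (∑ j, ∑ k, pd j (K.a i k) x * y j * y k)
        - K.Lx i x y) := by
    simp only [Lx, chr, Finset.mul_sum, ← Finset.sum_add_distrib, ← Finset.sum_sub_distrib]
    exact Finset.sum_congr rfl fun i _ => Finset.sum_congr rfl fun l _ => by ring
  rw [h3, h1, h2]
  ring

/-- The Euler-Lagrange expression of `β`. -/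
theorem euler_lagrange_β (hx : x ∈ U) (i : Fin n) :
    (∑ k, pd k (K.b i) x * y k) - K.βx i x y = 2 * K.slow i x y := by
  simp only [slow, βx, K.s_eq hx, Finset.mul_sum, ← Finset.sum_sub_distrib]
  exact Finset.sum_congr rfl fun l _ => by ring

/-- Contract `euler_lagrange_L` with `y`: its first term becomes twice the sum on the left, its
second term once that sum. -/
theorem sum_Lx (hx : x ∈ U) :
    ∑ k, K.Lx k x y * y k = 4 * ∑ l, K.Y l x y * K.Gbar l x y := by
  have h1 : ∑ i, y i * (4 * ∑ l, K.a i l x * K.Gbar l x y) =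
      4 * ∑ l, K.Y l x y * K.Gbar l x y := by
    simp only [Y, Finset.mul_sum, Finset.sum_mul]
    rw [Finset.sum_comm]
    refine Finset.sum_congr rfl fun i _ => Finset.sum_congr rfl fun l _ => ?_
    rw [K.symm_a l i x hx]; ring
  have h2 : ∑ i, y i * ∑ k, K.Yx k i x y * y k = ∑ k, K.Lx k x y * y k := by
    simp only [Yx, Lx, Finset.mul_sum, Finset.sum_mul]
    rw [Finset.sum_comm]
    refine Finset.sum_congr rfl fun i _ => Finset.sum_congr rfl fun l _ =>
      Finset.sum_congr rfl fun m _ => by ring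
  have h3 : ∑ i, y i * K.Lx i x y = ∑ k, K.Lx k x y * y k :=
    Finset.sum_congr rfl fun i _ => by ring
  rw [← h1]
  simp only [← K.euler_lagrange_L hx, mul_sub, Finset.sum_sub_distrib]
  rw [h3, ← h2]
  simp only [mul_left_comm _ (2 : ℝ), ← Finset.mul_sum]
  ring

theorem r00_eq (x y : EuclideanSpace ℝ (Fin n)) :
    K.r00 x y = ∑ j, ∑ k, K.nb j k x * y j * y k := by
  have h : ∑ j, ∑ k, K.nb k j x * y j * y k = ∑ j, ∑ k, K.nb j k x * y j * y k := by
    rw [Finset.sum_comm]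
    exact Finset.sum_congr rfl fun i _ => Finset.sum_congr rfl fun l _ => by ring
  have h' : K.r00 x y = 1 / 2 * ((∑ j, ∑ k, K.nb j k x * y j * y k) +
      ∑ j, ∑ k, K.nb k j x * y j * y k) := by
    simp only [r00, r, Finset.mul_sum, ← Finset.sum_add_distrib]
    exact Finset.sum_congr rfl fun i _ => Finset.sum_congr rfl fun l _ => by ring
  rw [h', h]; ring

/-- Replacing partial by covariant derivatives of `b` costs the Christoffel term, which contracted
twice with `y` is `2 b_l Gbar^l`. Only the symmetric part `r` survives that contraction. -/
theorem sum_βx (x y : EuclideanSpace ℝ (Fin n)) :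
    ∑ k, K.βx k x y * y k = K.r00 x y + 2 * ∑ l, K.b l x * K.Gbar l x y := by
  have h : 2 * ∑ l, K.b l x * K.Gbar l x y =
      ∑ j, ∑ k, (∑ i, K.Γ i j k x * K.b i x) * y j * y k := by
    simp only [Gbar, Finset.mul_sum, Finset.sum_mul]
    rw [Finset.sum_comm]
    refine Finset.sum_congr rfl fun i _ => ?_
    rw [Finset.sum_comm]
    refine Finset.sum_congr rfl fun l _ => Finset.sum_congr rfl fun m _ => by ring
  have h2 : ∑ k, K.βx k x y * y k = ∑ j, ∑ k, pd k (K.b j) x * y j * y k := by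
    simp only [βx, Finset.sum_mul]
    exact Finset.sum_comm
  rw [K.r00_eq, h, h2]
  simp only [← Finset.sum_add_distrib, nb]
  exact Finset.sum_congr rfl fun i _ => Finset.sum_congr rfl fun l _ => by ring

/-! ### Derivatives of `α²` and `β` -/

theorem hasPartial_β_right (k : Fin n) :
    HasPartial k (fun y' => K.β x y') y (K.b k x) := by
  refine (HasPartial.sum fun i _ => (HasPartial.coord i).const_mul (K.b i x)).congr_val ?_
  simp

theorem hasPartial_Y_right (i k : Fin n) :
    HasPartial k (fun y' => K.Y i x y') y (K.a i k x) := by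
  refine (HasPartial.sum fun j _ => (HasPartial.coord j).const_mul (K.a i j x)).congr_val ?_
  simp

theorem hasPartial_quadratic (c : Fin n → Fin n → ℝ) (k : Fin n) :
    HasPartial k (fun y' : EuclideanSpace ℝ (Fin n) => ∑ i, ∑ j, c i j * y' i * y' j) y
      (∑ j, (c k j + c j k) * y j) := by
  refine (HasPartial.sum fun i _ => HasPartial.sum fun j _ =>
    ((HasPartial.coord i).const_mul (c i j)).mul (HasPartial.coord j)).congr_val ?_
  simp [Finset.sum_add_distrib, add_mul]

theorem hasPartial_L_right (hx : x ∈ U) (k : Fin n) :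
    HasPartial k (fun y' => K.L x y') y (2 * K.Y k x y) := by
  refine (hasPartial_quadratic (fun i j => K.a i j x) k).congr_val ?_
  simp only [Y, Finset.mul_sum]
  refine Finset.sum_congr rfl fun j _ => ?_
  rw [K.symm_a j k x hx]; ring

theorem hasPartial_Lx_right (hx : x ∈ U) (m k : Fin n) :
    HasPartial k (fun y' => K.Lx m x y') y (2 * K.Yx m k x y) := by
  refine (hasPartial_quadratic (fun i j => pd m (K.a i j) x) k).congr_val ?_
  simp only [Yx, Finset.mul_sum]
  refine Finset.sum_congr rfl fun j _ => ?_
  rw [K.pd_symm_a hx m j k]; ring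

theorem hasPartial_βx_right (m k : Fin n) :
    HasPartial k (fun y' => K.βx m x y') y (pd m (K.b k) x) := by
  refine (HasPartial.sum fun i _ => (HasPartial.coord i).const_mul (pd m (K.b i) x)).congr_val ?_
  simp

theorem hasPartial_L_left (hx : x ∈ U) (k : Fin n) :
    HasPartial k (fun x' => K.L x' y) x (K.Lx k x y) :=
  HasPartial.sum fun i _ => HasPartial.sum fun j _ =>
    (((K.smooth_a i j).hasPartial K.isOpen hx k).mul_const _).mul_const _

theorem hasPartial_β_left (hx : x ∈ U) (k : Fin n) :
    HasPartial k (fun x' => K.β x' y) x (K.βx k x y) :=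
  HasPartial.sum fun i _ => ((K.smooth_b i).hasPartial K.isOpen hx k).mul_const _

/-! ### The domain -/

theorem smoothOn_β : SmoothOn (U ×ˢ Set.univ) K.β :=
  SmoothOn.sum fun i _ => (smoothOn_coef (K.smooth_b i) fun _ hp => hp.1).mul (smoothOn_coord i)

theorem isOpen_D : IsOpen K.D := by
  have h : ContinuousOn (fun p : EuclideanSpace ℝ (Fin n) × EuclideanSpace ℝ (Fin n) =>
      K.β p.1 p.2) (U ×ˢ Set.univ) := ContDiffOn.continuousOn K.smoothOn_β
  have := h.isOpen_inter_preimage (K.isOpen.prod isOpen_univ) (isOpen_Ioi (a := (0 : ℝ)))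
  convert this using 1
  ext p
  simp [D]

theorem β_smul (t : ℝ) : K.β x (t • y) = t * K.β x y := by
  simp only [β, Finset.mul_sum]
  exact Finset.sum_congr rfl fun i _ => by simp; ring

theorem D_cone (x y : EuclideanSpace ℝ (Fin n)) (h : (x, y) ∈ K.D) (t : ℝ) (ht : 0 < t) :
    (x, t • y) ∈ K.D := ⟨h.1, by
  have := mul_pos ht h.2
  rwa [← K.β_smul] at this⟩

theorem L_pos (h : (x, y) ∈ K.D) : 0 < K.L x y := by
  refine K.pos x h.1 y ?_
  rintro rfl
  have := h.2
  simp [β] at this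

/-! ### The geodesic coefficients -/

/-- The geodesic coefficients up to a projective change. -/
def Ghat (i : Fin n) : CoordFun n := fun x y =>
  K.Gbar i x y - 1 / 2 * K.L x y / K.β x y * K.σ i x y
    + 1 / 2 * (K.L x y / K.β x y * K.s0 x y + K.r00 x y) * K.B i x

/-- The projective factor. -/
def P : CoordFun n := fun x y => - K.r00 x y * K.β x y / K.L x y - K.s0 x y

variable {F : CoordFun n}

theorem fundamentalTensor_eq (hF : ∀ x y, (x, y) ∈ K.D → F x y = K.L x y / K.β x y)
    (h : (x, y) ∈ K.D) (i j : Fin n) : fundamentalTensor F x y i j =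
      2 * K.L x y / K.β x y ^ 2 * K.a i j x + 4 / K.β x y ^ 2 * K.Y i x y * K.Y j x y
      - 4 * K.L x y / K.β x y ^ 3 * (K.Y i x y * K.b j x + K.b i x * K.Y j x y)
      + 3 * K.L x y ^ 2 / K.β x y ^ 4 * K.b i x * K.b j x := by
  have h1 : ∀ x y, (x, y) ∈ K.D → dy i (square F) x y =
      4 * K.L x y * K.Y i x y * (K.β x y)⁻¹ ^ 2
        - 2 * (K.L x y * K.L x y) * (K.b i x) * (K.β x y)⁻¹ ^ 3 := fun x y h => by
    have hβ : K.β x y ≠ 0 := h.2.ne'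
    rw [dy_congr (g := fun x y => (K.L x y / K.β x y) * (K.L x y / K.β x y)) K.isOpen_D
      (fun x y h => by rw [square, hF x y h, sq]) i h]
    have hq := (K.hasPartial_L_right (y := y) h.1 i).div (K.hasPartial_β_right i) hβ
    refine (hq.mul hq).2.trans ?_
    field_simp
    ring
  simp only [fundamentalTensor, Matrix.of_apply]
  have hβ : K.β x y ≠ 0 := h.2.ne'
  rw [dy_congr K.isOpen_D h1 j h]
  have hL := K.hasPartial_L_right (y := y) h.1 j
  have hb := (K.hasPartial_β_right (x := x) (y := y) j).inv hβ
  have hY := K.hasPartial_Y_right (x := x) (y := y) i j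
  have := (((hL.const_mul 4).mul hY).mul (hb.mul hb)).sub
    ((((hL.mul hL).const_mul 2).mul_const (K.b i x)).mul ((hb.mul hb).mul hb))
  have e : (fun y' => 4 * K.L x y' * K.Y i x y' * (K.β x y')⁻¹ ^ 2
        - 2 * (K.L x y' * K.L x y') * (K.b i x) * (K.β x y')⁻¹ ^ 3) =
      (fun y' => 4 * K.L x y' * K.Y i x y' * ((K.β x y')⁻¹ * (K.β x y')⁻¹)
        - 2 * (K.L x y' * K.L x y') * (K.b i x) * ((K.β x y')⁻¹ * (K.β x y')⁻¹ * (K.β x y')⁻¹)) := by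
    funext y'; ring
  unfold dy
  rw [e, this.2]
  field_simp
  ring

/-- A null vector `v` of the fundamental tensor satisfies an equation in `a v`, `Y` and `b` whose
coefficients involve `v` only through `p = Y·v` and `q = b·v`. Contracting it with `y` and with `B`
gives a nonsingular linear system for `p` and `q`. Once these vanish, `a v = 0`, against positivity.
-/
theorem det_fundamentalTensor_ne_zero
    (hF : ∀ x y, (x, y) ∈ K.D → F x y = K.L x y / K.β x y) (h : (x, y) ∈ K.D) :
    (fundamentalTensor F x y).det ≠ 0 := by
  intro hdet
  obtain ⟨v, hv0, hv⟩ := Matrix.exists_mulVec_eq_zero_iff.mpr hdet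
  have hβ : 0 < K.β x y := h.2
  have hL := K.L_pos h
  set l := K.L x y with hl
  set c := K.β x y with hc
  set p := ∑ j, K.Y j x y * v j with hp
  set q := ∑ j, K.b j x * v j with hq
  have h1 : ∀ i, 2 * l / c ^ 2 * (∑ j, K.a i j x * v j) +
      (4 / c ^ 2 * p - 4 * l / c ^ 3 * q) * K.Y i x y +
      (3 * l ^ 2 / c ^ 4 * q - 4 * l / c ^ 3 * p) * K.b i x = 0 := fun i => by
    have := congrFun hv i
    simp only [Matrix.mulVec, dotProduct, K.fundamentalTensor_eq hF h, Pi.zero_apply] at this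
    rw [← this, hp, hq]
    simp only [Finset.mul_sum, Finset.sum_mul, ← Finset.sum_add_distrib,
      ← Finset.sum_sub_distrib]
    exact Finset.sum_congr rfl fun j _ => by ring
  have contract : ∀ w : Fin n → ℝ,
      2 * l / c ^ 2 * (∑ i, w i * ∑ j, K.a i j x * v j) +
      (4 / c ^ 2 * p - 4 * l / c ^ 3 * q) * (∑ i, K.Y i x y * w i) +
      (3 * l ^ 2 / c ^ 4 * q - 4 * l / c ^ 3 * p) * (∑ i, K.b i x * w i) = 0 := fun w => by
    have : ∑ i, w i * (2 * l / c ^ 2 * (∑ j, K.a i j x * v j) +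
      (4 / c ^ 2 * p - 4 * l / c ^ 3 * q) * K.Y i x y +
      (3 * l ^ 2 / c ^ 4 * q - 4 * l / c ^ 3 * p) * K.b i x) = 0 := by simp [h1]
    rw [← this]
    obtain ⟨w', hw'⟩ : ∃ w' : Fin n → ℝ, ∀ i, w' i = ∑ j, K.a i j x * v j := ⟨_, fun _ => rfl⟩
    simp only [← hw', Finset.mul_sum, ← Finset.sum_add_distrib]
    exact Finset.sum_congr rfl fun j _ => by ring
  have hcy := contract (fun i => y i)
  have hcB := contract (fun i => K.B i x)
  have e1 : ∀ w : Fin n → ℝ, ∑ i, w i * ∑ j, K.a i j x * v j =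
      ∑ j, (∑ i, K.a j i x * w i) * v j := fun w => by
    simp only [Finset.mul_sum, Finset.sum_mul]
    rw [Finset.sum_comm]
    refine Finset.sum_congr rfl fun i _ => Finset.sum_congr rfl fun j _ => ?_
    rw [K.symm_a i j x h.1]; ring
  rw [e1] at hcy hcB
  simp only [K.sum_a_B h.1] at hcB
  have e2 : ∑ j, (∑ i, K.a j i x * y i) * v j = p := rfl
  have e3 : ∑ i, K.b i x * y i = c := rfl
  rw [e2, e3, K.sum_Y_y, ← hl] at hcy
  rw [← hq, K.sum_Y_B h.1, K.sum_b_B h.1, ← hc] at hcB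
  have f1 : 2 * c * p = l * q := by
    field_simp at hcy
    have : l * (2 * c * p - l * q) = 0 := by linarith
    have := (mul_eq_zero.mp this).resolve_left hL.ne'
    linarith
  have q0 : q = 0 := by
    field_simp at hcB
    have : l ^ 2 * q = 0 := by linear_combination hcB - (2 * c ^ 2 - 2 * l) * f1
    simpa [hL.ne'] using this
  have p0 : p = 0 := by
    rw [q0, mul_zero] at f1
    simpa [hβ.ne'] using f1
  have hav : ∀ i, ∑ j, K.a i j x * v j = 0 := fun i => by
    have := h1 i
    rw [p0, q0] at this
    simpa [hL.ne', hβ.ne'] using this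
  have hpos := K.pos x h.1 (WithLp.toLp 2 v) (by simpa using hv0)
  have : ∑ i, ∑ j, K.a i j x * v i * v j = 0 := by
    have : ∀ i, ∑ j, K.a i j x * v i * v j = v i * ∑ j, K.a i j x * v j := fun i => by
      rw [Finset.mul_sum]; exact Finset.sum_congr rfl fun j _ => by ring
    simp [this, hav]
  exact hpos.ne' this

/-- The geodesic coefficients of a Kropina metric. -/
theorem geodesicCoeff_eq (hF : ∀ x y, (x, y) ∈ K.D → F x y = K.L x y / K.β x y)
    (h : (x, y) ∈ K.D) (i : Fin n) :
    geodesicCoeff F i x y = K.Ghat i x y + K.P x y * y i := by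
  have hβ0 : K.β x y ≠ 0 := h.2.ne'
  have hL0 : K.L x y ≠ 0 := (K.L_pos h).ne'
  have hdx : ∀ k x y, (x, y) ∈ K.D → dx k (square F) x y =
      2 * K.L x y * K.Lx k x y * ((K.β x y)⁻¹ * (K.β x y)⁻¹)
        - 2 * (K.L x y * K.L x y) * K.βx k x y * ((K.β x y)⁻¹ * (K.β x y)⁻¹ * (K.β x y)⁻¹) :=
    fun k x y h => by
    have hβ : K.β x y ≠ 0 := h.2.ne'
    rw [dx_congr (g := fun x y => (K.L x y / K.β x y) * (K.L x y / K.β x y)) K.isOpen_D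
      (fun x y h => by rw [square, hF x y h, sq]) k h]
    have hq := (K.hasPartial_L_left (y := y) h.1 k).div (K.hasPartial_β_left h.1 k) hβ
    refine (hq.mul hq).2.trans ?_
    field_simp
    ring
  have hdydx : ∀ l k, dy l (dx k (square F)) x y =
      (4 * K.Y l x y * K.Lx k x y + 4 * K.L x y * K.Yx k l x y) / K.β x y ^ 2
      - 4 * K.L x y * K.Lx k x y * K.b l x / K.β x y ^ 3
      - (8 * K.L x y * K.Y l x y * K.βx k x y + 2 * K.L x y ^ 2 * pd k (K.b l) x) / K.β x y ^ 3
      + 6 * K.L x y ^ 2 * K.βx k x y * K.b l x / K.β x y ^ 4 := fun l k => by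
    rw [dy_congr K.isOpen_D (hdx k) l h]
    have hL := K.hasPartial_L_right (y := y) h.1 l
    have hb := (K.hasPartial_β_right (x := x) (y := y) l).inv hβ0
    refine ((((hL.const_mul 2).mul (K.hasPartial_Lx_right h.1 k l)).mul (hb.mul hb)).sub
      ((((hL.mul hL).const_mul 2).mul (K.hasPartial_βx_right k l)).mul
        ((hb.mul hb).mul hb))).2.trans ?_
    field_simp
    ring
  have hsum : ∀ l, (∑ k, dy l (dx k (square F)) x y * y k) - dx l (square F) x y =
      (4 * K.Y l x y * (∑ k, K.Lx k x y * y k)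
        + 2 * K.L x y * (2 * (∑ k, K.Yx k l x y * y k) - K.Lx l x y)) / K.β x y ^ 2
      - 4 * K.L x y * (∑ k, K.Lx k x y * y k) * K.b l x / K.β x y ^ 3
      - (8 * K.L x y * K.Y l x y * (∑ k, K.βx k x y * y k)
        + 2 * K.L x y ^ 2 * ((∑ k, pd k (K.b l) x * y k) - K.βx l x y)) / K.β x y ^ 3
      + 6 * K.L x y ^ 2 * (∑ k, K.βx k x y * y k) * K.b l x / K.β x y ^ 4 := fun l => by
    have e : ∑ k, dy l (dx k (square F)) x y * y k =
      (4 * K.Y l x y * (∑ k, K.Lx k x y * y k)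
        + 2 * K.L x y * (2 * (∑ k, K.Yx k l x y * y k))) / K.β x y ^ 2
      - 4 * K.L x y * (∑ k, K.Lx k x y * y k) * K.b l x / K.β x y ^ 3
      - (8 * K.L x y * K.Y l x y * (∑ k, K.βx k x y * y k)
        + 2 * K.L x y ^ 2 * (∑ k, pd k (K.b l) x * y k)) / K.β x y ^ 3
      + 6 * K.L x y ^ 2 * (∑ k, K.βx k x y * y k) * K.b l x / K.β x y ^ 4 := by
      simp only [hdydx, Finset.mul_sum, Finset.sum_mul, ← Finset.sum_add_distrib,
        ← Finset.sum_sub_distrib, Finset.sum_div]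
      exact Finset.sum_congr rfl fun j _ => by ring
    rw [e, hdx l x y h]
    field_simp
    ring
  -- Applying the fundamental tensor to a vector requires only its contractions with `Y`, with `b`
  -- and with `a`; these are computed here for the claimed coefficients.
  have sY : ∑ l, K.Y l x y * (K.Ghat l x y + K.P x y * y l) =
      (∑ l, K.Y l x y * K.Gbar l x y)
      - 1 / 2 * K.β x y * (K.L x y / K.β x y * K.s0 x y + K.r00 x y) := by
    have e : ∑ l, K.Y l x y * (K.Ghat l x y + K.P x y * y l) =
        (∑ l, K.Y l x y * K.Gbar l x y) - 1 / 2 * K.L x y / K.β x y * (∑ l, K.Y l x y * K.σ l x y)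
        + 1 / 2 * (K.L x y / K.β x y * K.s0 x y + K.r00 x y) * (∑ l, K.Y l x y * K.B l x)
        + K.P x y * ∑ l, K.Y l x y * y l := by
      simp only [Ghat, Finset.mul_sum, ← Finset.sum_add_distrib, ← Finset.sum_sub_distrib]
      exact Finset.sum_congr rfl fun j _ => by ring
    rw [e, K.sum_Y_σ h.1, K.sum_Y_B h.1, K.sum_Y_y, P]
    field_simp
    ring
  have sb : ∑ l, K.b l x * (K.Ghat l x y + K.P x y * y l) =
      (∑ l, K.b l x * K.Gbar l x y) + 1 / 2 * K.r00 x y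
      - K.β x y ^ 2 / K.L x y * (K.L x y / K.β x y * K.s0 x y + K.r00 x y) := by
    have e : ∑ l, K.b l x * (K.Ghat l x y + K.P x y * y l) =
        (∑ l, K.b l x * K.Gbar l x y) - 1 / 2 * K.L x y / K.β x y * (∑ l, K.b l x * K.σ l x y)
        + 1 / 2 * (K.L x y / K.β x y * K.s0 x y + K.r00 x y) * (∑ l, K.b l x * K.B l x)
        + K.P x y * ∑ l, K.b l x * y l := by
      simp only [Ghat, Finset.mul_sum, ← Finset.sum_add_distrib, ← Finset.sum_sub_distrib]
      exact Finset.sum_congr rfl fun j _ => by ring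
    have e3 : ∑ i, K.b i x * y i = K.β x y := rfl
    rw [e, K.sum_b_σ h.1, K.sum_b_B h.1, e3, P]
    field_simp
    ring
  have sa : ∀ i, ∑ l, K.a i l x * (K.Ghat l x y + K.P x y * y l) =
      (∑ l, K.a i l x * K.Gbar l x y) - 1 / 2 * K.L x y / K.β x y * K.slow i x y
        + 1 / 2 * (K.L x y / K.β x y * K.s0 x y + K.r00 x y) * K.b i x
        + K.P x y * K.Y i x y := fun i => by
    rw [← K.sum_a_σ h.1, ← K.sum_a_B h.1 i, Y]
    simp only [Ghat, Finset.mul_sum, ← Finset.sum_add_distrib, ← Finset.sum_sub_distrib]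
    exact Finset.sum_congr rfl fun j _ => by ring
  -- Instead of computing the inverse tensor, apply the fundamental tensor to the claimed solution
  -- and compare with the Euler-Lagrange expression of `F²`. Nondegeneracy then identifies the two.
  have key : (fundamentalTensor F x y).mulVec (fun l => 4 * (K.Ghat l x y + K.P x y * y l)) =
      fun l => (∑ k, dy l (dx k (square F)) x y * y k) - dx l (square F) x y := by
    funext i
    rw [hsum, K.euler_lagrange_L h.1, K.euler_lagrange_β h.1, K.sum_Lx h.1, K.sum_βx]
    have e : (fundamentalTensor F x y).mulVec (fun l => 4 * (K.Ghat l x y + K.P x y * y l)) i =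
        8 * K.L x y / K.β x y ^ 2 * (∑ l, K.a i l x * (K.Ghat l x y + K.P x y * y l))
        + (16 / K.β x y ^ 2 * K.Y i x y - 16 * K.L x y / K.β x y ^ 3 * K.b i x) *
          (∑ l, K.Y l x y * (K.Ghat l x y + K.P x y * y l))
        + (12 * K.L x y ^ 2 / K.β x y ^ 4 * K.b i x - 16 * K.L x y / K.β x y ^ 3 * K.Y i x y) *
          (∑ l, K.b l x * (K.Ghat l x y + K.P x y * y l)) := by
      simp only [Matrix.mulVec, dotProduct, K.fundamentalTensor_eq hF h, Finset.mul_sum,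
        ← Finset.sum_add_distrib]
      exact Finset.sum_congr rfl fun j _ => by ring
    rw [e, sa, sY, sb, P]
    field_simp
    ring
  have hinv := congrArg (fun w => (fundamentalTensor F x y)⁻¹.mulVec w) key
  simp only [Matrix.mulVec_mulVec] at hinv
  rw [Matrix.nonsing_inv_mul _ (isUnit_iff_ne_zero.mpr (K.det_fundamentalTensor_ne_zero hF h)),
    Matrix.one_mulVec] at hinv
  have := congrFun hinv i
  simp only [Matrix.mulVec, dotProduct] at this
  unfold geodesicCoeff
  rw [← this]
  ring

end UnitForm

/-! ### Rational functions of `y` -/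

namespace CoordFun

variable {n : ℕ} {U : Set (EuclideanSpace ℝ (Fin n))}
  {D : Set (EuclideanSpace ℝ (Fin n) × EuclideanSpace ℝ (Fin n))} {den : CoordFun n}
  {f g : CoordFun n} {x y : EuclideanSpace ℝ (Fin n)}

/-- The functions on `D` which are polynomial in `y` and in the inverse of `den`, with coefficients
which are smooth functions of `x ∈ U`. -/
inductive RationalOn (U : Set (EuclideanSpace ℝ (Fin n)))
    (D : Set (EuclideanSpace ℝ (Fin n) × EuclideanSpace ℝ (Fin n))) (den : CoordFun n) :
    CoordFun n → Prop
  | coef (c : EuclideanSpace ℝ (Fin n) → ℝ) (hc : ContDiffOn ℝ ∞ c U) :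
      RationalOn U D den (fun x _ => c x)
  | coord (i : Fin n) : RationalOn U D den (fun _ y => y i)
  | inv : RationalOn U D den (fun x y => (den x y)⁻¹)
  | add {f g : CoordFun n} (hf : RationalOn U D den f) (hg : RationalOn U D den g) :
      RationalOn U D den (fun x y => f x y + g x y)
  | mul {f g : CoordFun n} (hf : RationalOn U D den f) (hg : RationalOn U D den g) :
      RationalOn U D den (fun x y => f x y * g x y)
  | congr {f g : CoordFun n} (hf : RationalOn U D den f)
      (h : ∀ x y, (x, y) ∈ D → g x y = f x y) : RationalOn U D den g

namespace RationalOn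

theorem const (c : ℝ) : RationalOn U D den (fun _ _ => c) := coef (fun _ => c) contDiffOn_const

theorem const_mul (c : ℝ) (hf : RationalOn U D den f) :
    RationalOn U D den (fun x y => c * f x y) := (const c).mul hf

theorem neg (hf : RationalOn U D den f) : RationalOn U D den (fun x y => - f x y) :=
  (hf.const_mul (-1)).congr fun x y _ => by ring

theorem sub (hf : RationalOn U D den f) (hg : RationalOn U D den g) :
    RationalOn U D den (fun x y => f x y - g x y) :=
  (hf.add hg.neg).congr fun x y _ => by ring

theorem sum {ι : Type*} {s : Finset ι} {f : ι → CoordFun n}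
    (h : ∀ i ∈ s, RationalOn U D den (f i)) : RationalOn U D den (fun x y => ∑ i ∈ s, f i x y) := by
  classical
  induction s using Finset.induction_on with
  | empty => simpa using const 0
  | insert a s ha ih =>
    simp only [Finset.sum_insert ha]
    exact (h a (Finset.mem_insert_self a s)).add
      (ih fun i hi => h i (Finset.mem_insert_of_mem hi))

theorem smoothOn (hf : RationalOn U D den f) (hDU : ∀ p ∈ D, p.1 ∈ U) (hden : SmoothOn D den)
    (h0 : ∀ x y, (x, y) ∈ D → den x y ≠ 0) : SmoothOn D f := by
  induction hf with
  | coef c hc => exact smoothOn_coef hc hDU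
  | coord i => exact smoothOn_coord i
  | inv => exact hden.inv h0
  | add _ _ hf hg => exact hf.add hg
  | mul _ _ hf hg => exact hf.mul hg
  | congr _ h hf => exact hf.congr h

/-- Only the generator `1/den` needs an assumption: its derivative is `-den'/den²`, so `den'` must
itself lie in the class. -/
theorem dx (hf : RationalOn U D den f) (hU : IsOpen U) (hD : IsOpen D) (hDU : ∀ p ∈ D, p.1 ∈ U)
    (hden : SmoothOn D den) (h0 : ∀ x y, (x, y) ∈ D → den x y ≠ 0) (k : Fin n)
    (hk : RationalOn U D den (dx k den)) : RationalOn U D den (dx k f) := by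
  induction hf with
  | coef c hc => exact coef (pd k c) (hc.pd hU k)
  | coord i => exact (const 0).congr fun x y _ => (HasPartial.const (y i)).2
  | inv =>
    refine (hk.neg.mul (inv.mul inv)).congr fun x y hp => ?_
    refine ((hden.hasPartial_left hD hp k).inv (h0 x y hp)).2.trans ?_
    rw [div_eq_mul_inv]
    ring
  | add hf hg ihf ihg =>
    exact (ihf.add ihg).congr fun x y hp =>
      (((hf.smoothOn hDU hden h0).hasPartial_left hD hp k).add
        ((hg.smoothOn hDU hden h0).hasPartial_left hD hp k)).2
  | mul hf hg ihf ihg =>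
    exact ((ihf.mul hg).add (hf.mul ihg)).congr fun x y hp =>
      (((hf.smoothOn hDU hden h0).hasPartial_left hD hp k).mul
        ((hg.smoothOn hDU hden h0).hasPartial_left hD hp k)).2
  | congr _ h ihf => exact ihf.congr fun x y hp => dx_congr hD h k hp

theorem dy (hf : RationalOn U D den f) (hD : IsOpen D) (hDU : ∀ p ∈ D, p.1 ∈ U)
    (hden : SmoothOn D den) (h0 : ∀ x y, (x, y) ∈ D → den x y ≠ 0) (k : Fin n)
    (hk : RationalOn U D den (dy k den)) : RationalOn U D den (dy k f) := by
  induction hf with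
  | coef c hc => exact (const 0).congr fun x y _ => (HasPartial.const (c x)).2
  | coord i =>
    exact (const (if i = k then 1 else 0)).congr fun x y _ => (HasPartial.coord i).2
  | inv =>
    refine (hk.neg.mul (inv.mul inv)).congr fun x y hp => ?_
    refine ((hden.hasPartial_right hD hp k).inv (h0 x y hp)).2.trans ?_
    rw [div_eq_mul_inv]
    ring
  | add hf hg ihf ihg =>
    exact (ihf.add ihg).congr fun x y hp =>
      (((hf.smoothOn hDU hden h0).hasPartial_right hD hp k).add
        ((hg.smoothOn hDU hden h0).hasPartial_right hD hp k)).2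
  | mul hf hg ihf ihg =>
    exact ((ihf.mul hg).add (hf.mul ihg)).congr fun x y hp =>
      (((hf.smoothOn hDU hden h0).hasPartial_right hD hp k).mul
        ((hg.smoothOn hDU hden h0).hasPartial_right hD hp k)).2
  | congr _ h ihf => exact ihf.congr fun x y hp => dy_congr hD h k hp

/-- On a half-line on which `den` is the parameter, a rational function of `y` is a
Laurent polynomial. -/
theorem restrict_line (hf : RationalOn U D den f) {w v : EuclideanSpace ℝ (Fin n)}
    (hline : ∀ t : ℝ, 0 < t → (x, t • w + v) ∈ D ∧ den x (t • w + v) = t) :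
    ∃ (q : Polynomial ℝ) (k : ℕ), ∀ t : ℝ, 0 < t → f x (t • w + v) * t ^ k = q.eval t := by
  induction hf with
  | coef c _ => exact ⟨Polynomial.C (c x), 0, fun t _ => by simp⟩
  | coord i =>
    exact ⟨Polynomial.X * Polynomial.C (w i) + Polynomial.C (v i), 0, fun t _ => by simp; ring⟩
  | inv => exact ⟨1, 1, fun t ht => by simp [(hline t ht).2, ht.ne']⟩
  | add _ _ ihf ihg =>
    obtain ⟨q, k, hq⟩ := ihf
    obtain ⟨q', k', hq'⟩ := ihg
    refine ⟨q * Polynomial.X ^ k' + q' * Polynomial.X ^ k, k + k', fun t ht => ?_⟩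
    simp only [Polynomial.eval_add, Polynomial.eval_mul, Polynomial.eval_pow, Polynomial.eval_X,
      ← hq t ht, ← hq' t ht]
    ring
  | mul _ _ ihf ihg =>
    obtain ⟨q, k, hq⟩ := ihf
    obtain ⟨q', k', hq'⟩ := ihg
    refine ⟨q * q', k + k', fun t ht => ?_⟩
    simp only [Polynomial.eval_mul, ← hq t ht, ← hq' t ht]
    ring
  | congr _ h ihf =>
    obtain ⟨q, k, hq⟩ := ihf
    exact ⟨q, k, fun t ht => by rw [h _ _ (hline t ht).1, hq t ht]⟩

end RationalOn

end CoordFun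

/-! ### A divisibility argument over the complex numbers. -/

/-- A quadratic polynomial without real roots which divides the square of a linear polynomial times
a monomial forces the linear polynomial to vanish. -/
theorem linear_eq_zero_of_dvd {c c0 c1 l : ℝ} (hc : c ≠ 0) (hl : 0 < l) (q : Polynomial ℝ) (k : ℕ)
    (h : ∀ t : ℝ, 0 < t → c * t ^ k * (c0 + c1 * t) ^ 2 = (t ^ 2 + l) * q.eval t) :
    c0 = 0 ∧ c1 = 0 := by
  have hpoly : Polynomial.C c * Polynomial.X ^ k *
      (Polynomial.C c0 + Polynomial.C c1 * Polynomial.X) ^ 2 =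
      (Polynomial.X ^ 2 + Polynomial.C l) * q := by
    refine Polynomial.eq_of_infinite_eval_eq _ _ ((Set.Ioi_infinite (0 : ℝ)).mono fun t ht => ?_)
    simpa using h t ht
  -- At the root `i √l` of the quadratic factor the right side vanishes. On the left `c` and the
  -- power of `i √l` are nonzero, so the affine factor vanishes, and its real and imaginary parts
  -- give `c0 = 0` and `c1 = 0`.
  have hz := congrArg (Polynomial.aeval (Complex.I * (Real.sqrt l : ℂ))) hpoly
  have hs : ((Real.sqrt l : ℝ) : ℂ) ^ 2 = (l : ℂ) := by
    rw [← Complex.ofReal_pow, Real.sq_sqrt hl.le]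
  have hs0 : Real.sqrt l ≠ 0 := (Real.sqrt_pos.mpr hl).ne'
  have hr : (Polynomial.aeval (Complex.I * (Real.sqrt l : ℂ)))
      (Polynomial.X ^ 2 + Polynomial.C l) = (0 : ℂ) := by
    simp [mul_pow, hs]
  rw [map_mul _ (Polynomial.X ^ 2 + Polynomial.C l), hr, zero_mul] at hz
  simp only [map_mul, map_pow, map_add, Polynomial.aeval_C, Polynomial.aeval_X,
    Complex.coe_algebraMap] at hz
  have hz' : (c0 : ℂ) + c1 * (Complex.I * (Real.sqrt l : ℂ)) = 0 := by
    rcases mul_eq_zero.mp hz with h1 | h1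
    · rcases mul_eq_zero.mp h1 with h2 | h2
      · exact absurd (Complex.ofReal_eq_zero.mp h2) hc
      · exact absurd (eq_zero_of_pow_eq_zero h2) (by simp [hs0])
    · exact pow_eq_zero_iff (two_ne_zero) |>.mp h1
  have hre := congrArg Complex.re hz'
  have him := congrArg Complex.im hz'
  simp at hre him
  exact ⟨hre, him.resolve_right hs0⟩

namespace UnitForm

open CoordFun

variable {n : ℕ} {U : Set (EuclideanSpace ℝ (Fin n))} (K : UnitForm n U)
  {x y : EuclideanSpace ℝ (Fin n)}
  {D : Set (EuclideanSpace ℝ (Fin n) × EuclideanSpace ℝ (Fin n))} {den : CoordFun n}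

/-! ### Smoothness of the coefficients -/

theorem smooth_B (i : Fin n) : ContDiffOn ℝ ∞ (K.B i) U :=
  ContDiffOn.sum fun j _ => (K.smooth_ai i j).mul (K.smooth_b j)

theorem smooth_Γ (i j k : Fin n) : ContDiffOn ℝ ∞ (K.Γ i j k) U :=
  ContDiffOn.sum fun l _ => (K.smooth_ai i l).mul <| contDiffOn_const.mul <|
    (((K.smooth_a l j).pd K.isOpen k).add ((K.smooth_a l k).pd K.isOpen j)).sub
      ((K.smooth_a j k).pd K.isOpen l)

theorem smooth_nb (j k : Fin n) : ContDiffOn ℝ ∞ (K.nb j k) U :=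
  ((K.smooth_b j).pd K.isOpen k).sub <|
    ContDiffOn.sum fun i _ => (K.smooth_Γ i j k).mul (K.smooth_b i)

theorem smooth_r (j k : Fin n) : ContDiffOn ℝ ∞ (K.r j k) U :=
  contDiffOn_const.mul ((K.smooth_nb j k).add (K.smooth_nb k j))

theorem smooth_s (j k : Fin n) : ContDiffOn ℝ ∞ (K.s j k) U :=
  contDiffOn_const.mul ((K.smooth_nb j k).sub (K.smooth_nb k j))

theorem rationalOn_linear {c : Fin n → EuclideanSpace ℝ (Fin n) → ℝ}
    (hc : ∀ i, ContDiffOn ℝ ∞ (c i) U) :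
    RationalOn U D den (fun x y => ∑ i, c i x * y i) :=
  RationalOn.sum fun i _ => (RationalOn.coef _ (hc i)).mul (RationalOn.coord i)

theorem rationalOn_quadratic {c : Fin n → Fin n → EuclideanSpace ℝ (Fin n) → ℝ}
    (hc : ∀ i j, ContDiffOn ℝ ∞ (c i j) U) :
    RationalOn U D den (fun x y => ∑ i, ∑ j, c i j x * y i * y j) :=
  RationalOn.sum fun i _ => RationalOn.sum fun j _ =>
    ((RationalOn.coef _ (hc i j)).mul (RationalOn.coord i)).mul (RationalOn.coord j)

theorem rationalOn_L : RationalOn U D den K.L := rationalOn_quadratic K.smooth_a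

theorem rationalOn_β : RationalOn U D den K.β := rationalOn_linear K.smooth_b

theorem rationalOn_Y (i : Fin n) : RationalOn U D den (K.Y i) := rationalOn_linear (K.smooth_a i)

theorem rationalOn_Gbar (i : Fin n) : RationalOn U D den (K.Gbar i) :=
  (rationalOn_quadratic (K.smooth_Γ i)).const_mul _

theorem rationalOn_r00 : RationalOn U D den K.r00 := rationalOn_quadratic K.smooth_r

theorem rationalOn_slow (i : Fin n) : RationalOn U D den (K.slow i) :=
  rationalOn_linear (K.smooth_s i)

theorem rationalOn_σ (i : Fin n) : RationalOn U D den (K.σ i) :=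
  RationalOn.sum fun l _ => (RationalOn.coef _ (K.smooth_ai i l)).mul (K.rationalOn_slow l)

theorem rationalOn_s0 : RationalOn U D den K.s0 :=
  RationalOn.sum fun l _ => (RationalOn.coef _ (K.smooth_B l)).mul (K.rationalOn_slow l)

/-- The point is that `L` does not occur in the denominator: the pole along `L = 0` is confined to
the projective factor `P`. -/
theorem rationalOn_Ghat (i : Fin n) : RationalOn U D K.β (K.Ghat i) := by
  refine (((K.rationalOn_Gbar i).sub ((K.rationalOn_L.mul RationalOn.inv).mul
    ((K.rationalOn_σ i).const_mul (1 / 2)))).add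
    ((((K.rationalOn_L.mul RationalOn.inv).mul K.rationalOn_s0).add K.rationalOn_r00).mul
      ((RationalOn.coef _ (K.smooth_B i)).const_mul (1 / 2)))).congr fun x y _ => ?_
  unfold Ghat
  ring

theorem mem_of_mem_D (p : EuclideanSpace ℝ (Fin n) × EuclideanSpace ℝ (Fin n)) (hp : p ∈ K.D) :
    p.1 ∈ U := hp.1

theorem β_ne_zero (x y : EuclideanSpace ℝ (Fin n)) (hp : (x, y) ∈ K.D) : K.β x y ≠ 0 := hp.2.ne'

theorem smoothOn_β_D : SmoothOn K.D K.β := K.smoothOn_β.mono fun _ hp => ⟨hp.1, trivial⟩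

variable {f : CoordFun n}

theorem smoothOn_of_rationalOn (hf : RationalOn U K.D K.β f) : SmoothOn K.D f :=
  hf.smoothOn K.mem_of_mem_D K.smoothOn_β_D K.β_ne_zero

theorem rationalOn_dx (hf : RationalOn U K.D K.β f) (k : Fin n) :
    RationalOn U K.D K.β (dx k f) :=
  hf.dx K.isOpen K.isOpen_D K.mem_of_mem_D K.smoothOn_β_D K.β_ne_zero k <|
    (rationalOn_linear (c := fun i => pd k (K.b i)) fun i => (K.smooth_b i).pd K.isOpen k).congr
      fun _ _ hp => (K.hasPartial_β_left hp.1 k).2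

theorem rationalOn_dy (hf : RationalOn U K.D K.β f) (k : Fin n) :
    RationalOn U K.D K.β (dy k f) :=
  hf.dy K.isOpen_D K.mem_of_mem_D K.smoothOn_β_D K.β_ne_zero k <|
    (RationalOn.coef _ (K.smooth_b k)).congr fun _ _ _ => (K.hasPartial_β_right k).2

theorem rationalOn_sprayRicci {G : Fin n → CoordFun n}
    (hG : ∀ i, RationalOn U K.D K.β (G i)) : RationalOn U K.D K.β (sprayRicci G) := by
  have hdiv : RationalOn U K.D K.β (divY G) :=
    RationalOn.sum fun k _ => K.rationalOn_dy (hG k) k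
  exact ((((RationalOn.sum fun k _ => K.rationalOn_dx (hG k) k).const_mul 2).sub
    (RationalOn.sum fun m _ => (K.rationalOn_dx hdiv m).mul (RationalOn.coord m))).add
    ((RationalOn.sum fun m _ => (hG m).mul (K.rationalOn_dy hdiv m)).const_mul 2)).sub
    (RationalOn.sum fun i _ => RationalOn.sum fun m _ =>
      (K.rationalOn_dy (hG i) m).mul (K.rationalOn_dy (hG m) i))

/-! ### Homogeneity -/

theorem linear_smul (c : Fin n → ℝ) (t : ℝ) (y : EuclideanSpace ℝ (Fin n)) :
    ∑ i, c i * (t • y) i = t * ∑ i, c i * y i := by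
  simp only [Finset.mul_sum]
  exact Finset.sum_congr rfl fun i _ => by simp; ring

theorem quadratic_smul (c : Fin n → Fin n → ℝ) (t : ℝ) (y : EuclideanSpace ℝ (Fin n)) :
    ∑ i, ∑ j, c i j * (t • y) i * (t • y) j = t ^ 2 * ∑ i, ∑ j, c i j * y i * y j := by
  simp only [Finset.mul_sum]
  exact Finset.sum_congr rfl fun i _ => Finset.sum_congr rfl fun j _ => by simp; ring

theorem L_smul (t : ℝ) : K.L x (t • y) = t ^ 2 * K.L x y := quadratic_smul _ t y

theorem r00_smul (t : ℝ) : K.r00 x (t • y) = t ^ 2 * K.r00 x y := quadratic_smul _ t y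

theorem Gbar_smul (i : Fin n) (t : ℝ) : K.Gbar i x (t • y) = t ^ 2 * K.Gbar i x y := by
  unfold Gbar
  rw [quadratic_smul (fun j k => K.Γ i j k x) t y]; ring

theorem slow_smul (i : Fin n) (t : ℝ) : K.slow i x (t • y) = t * K.slow i x y := linear_smul _ t y

theorem σ_smul (i : Fin n) (t : ℝ) : K.σ i x (t • y) = t * K.σ i x y := by
  simp only [σ, slow_smul, Finset.mul_sum]
  exact Finset.sum_congr rfl fun i _ => by ring

theorem s0_smul (t : ℝ) : K.s0 x (t • y) = t * K.s0 x y := by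
  simp only [s0, slow_smul, Finset.mul_sum]
  exact Finset.sum_congr rfl fun i _ => by ring

theorem homogeneousOn_Ghat (i : Fin n) : HomogeneousOn K.D 2 (K.Ghat i) := by
  intro x y hp t ht
  have := K.β_ne_zero x y hp
  simp only [Ghat, L_smul, β_smul, r00_smul, Gbar_smul, σ_smul, s0_smul]
  field_simp

theorem homogeneousOn_P : HomogeneousOn K.D 1 K.P := by
  intro x y hp t ht
  have := (K.L_pos hp).ne'
  simp only [P, L_smul, β_smul, r00_smul, s0_smul]
  field_simp

/-! ### The pole of the Ricci curvature along `α² = 0` -/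

/-- The geodesic spray of `a` preserves `α²`, by `sum_Lx`, and `σ` is orthogonal to `y`. Only the
part of `Ghat` along `B` contributes, through `Y·B = β`. -/
theorem spray_L (hp : (x, y) ∈ K.D) :
    (∑ m, y m * K.Lx m x y) - 2 * ∑ m, K.Ghat m x y * (2 * K.Y m x y) =
      - 2 * K.L x y * K.s0 x y - 2 * K.β x y * K.r00 x y := by
  have hβ := K.β_ne_zero x y hp
  have e : ∑ m, K.Ghat m x y * (2 * K.Y m x y) = 2 * ((∑ l, K.Y l x y * K.Gbar l x y)
      - 1 / 2 * K.L x y / K.β x y * (∑ l, K.Y l x y * K.σ l x y)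
      + 1 / 2 * (K.L x y / K.β x y * K.s0 x y + K.r00 x y) * ∑ l, K.Y l x y * K.B l x) := by
    simp only [Ghat, Finset.mul_sum, ← Finset.sum_add_distrib, ← Finset.sum_sub_distrib]
    exact Finset.sum_congr rfl fun j _ => by ring
  have e2 : ∑ m, y m * K.Lx m x y = ∑ m, K.Lx m x y * y m :=
    Finset.sum_congr rfl fun j _ => by ring
  rw [e, e2, K.sum_Lx hp.1, K.sum_Y_σ hp.1, K.sum_Y_B hp.1]
  field_simp
  ring

/-- The Ricci curvature has a double pole along `α² = 0`, with coefficient `r_00²`. -/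
theorem exists_sprayRicci_eq : ∃ N : CoordFun n, RationalOn U K.D K.β N ∧ ∀ x y, (x, y) ∈ K.D →
    K.L x y ^ 2 * sprayRicci (fun i x y => K.Ghat i x y + K.P x y * y i) x y =
      3 * (n - 1) * K.β x y ^ 2 * K.r00 x y ^ 2 + K.L x y * N x y := by
  have hp : RationalOn U K.D K.β (fun x y => K.r00 x y * K.β x y) :=
    K.rationalOn_r00.mul K.rationalOn_β
  have hs : RationalOn U K.D K.β K.s0 := K.rationalOn_s0
  have hS : ∀ f, RationalOn U K.D K.β f → RationalOn U K.D K.β (fun x y =>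
      (∑ m, y m * dx m f x y) - 2 * ∑ m, K.Ghat m x y * dy m f x y) := fun f hf =>
    (RationalOn.sum fun m _ => (RationalOn.coord m).mul (K.rationalOn_dx hf m)).sub
      ((RationalOn.sum fun m _ => (K.rationalOn_Ghat m).mul (K.rationalOn_dy hf m)).const_mul 2)
  have hP : SmoothOn K.D K.P :=
    ((K.smoothOn_of_rationalOn hp.neg).div (K.smoothOn_of_rationalOn K.rationalOn_L)
      fun x y h => (K.L_pos h).ne').sub (K.smoothOn_of_rationalOn hs) |>.congr fun x y _ => by
        unfold P; ring
  -- With `p = r00 β` and `S` the derivation along `Ghat`, the witness is `L Ric(Ghat) + (n-1)(4 s0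
  -- p + s0² L + S(p) + L S(s0))`. In the coefficient of `s0 p`, `2` comes from `P²` and `2` from
  -- the `s0` term of `S(L)`.
  refine ⟨fun x y => K.L x y * sprayRicci K.Ghat x y + (n - 1) *
    (((4 * (K.s0 x y * (K.r00 x y * K.β x y)) + (K.s0 x y * K.s0 x y) * K.L x y) +
      ((∑ m, y m * dx m (fun x y => K.r00 x y * K.β x y) x y)
        - 2 * ∑ m, K.Ghat m x y * dy m (fun x y => K.r00 x y * K.β x y) x y)) +
      K.L x y * ((∑ m, y m * dx m K.s0 x y) - 2 * ∑ m, K.Ghat m x y * dy m K.s0 x y)),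
    (K.rationalOn_L.mul (K.rationalOn_sprayRicci K.rationalOn_Ghat)).add
      (RationalOn.const_mul _ ((((((hs.mul hp).const_mul 4)).add
        ((hs.mul hs).mul K.rationalOn_L)).add (hS _ hp)).add (K.rationalOn_L.mul (hS _ hs)))),
    fun x y h => ?_⟩
  have hL := (K.L_pos h).ne'
  have hPe : ∀ x y, (x, y) ∈ K.D →
      K.P x y = -(K.r00 x y * K.β x y / K.L x y) - K.s0 x y := fun x y _ => by unfold P; ring
  have hx : ∀ m, dx m K.P x y =
      -((dx m (fun x y => K.r00 x y * K.β x y) x y * K.L x y -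
        K.r00 x y * K.β x y * K.Lx m x y) / K.L x y ^ 2) - dx m K.s0 x y := fun m => by
    rw [dx_congr K.isOpen_D hPe m h]
    exact ((((K.smoothOn_of_rationalOn hp).hasPartial_left K.isOpen_D h m).div
      (K.hasPartial_L_left h.1 m) hL).neg.sub
        ((K.smoothOn_of_rationalOn hs).hasPartial_left K.isOpen_D h m)).2
  have hy : ∀ m, dy m K.P x y =
      -((dy m (fun x y => K.r00 x y * K.β x y) x y * K.L x y -
        K.r00 x y * K.β x y * (2 * K.Y m x y)) / K.L x y ^ 2) - dy m K.s0 x y := fun m => by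
    rw [dy_congr K.isOpen_D hPe m h]
    exact ((((K.smoothOn_of_rationalOn hp).hasPartial_right K.isOpen_D h m).div
      (K.hasPartial_L_right h.1 m) hL).neg.sub
        ((K.smoothOn_of_rationalOn hs).hasPartial_right K.isOpen_D h m)).2
  have ex : ∑ m, y m * dx m K.P x y =
      - (1 / K.L x y) * (∑ m, y m * dx m (fun x y => K.r00 x y * K.β x y) x y)
      + K.r00 x y * K.β x y / K.L x y ^ 2 * (∑ m, y m * K.Lx m x y)
      - ∑ m, y m * dx m K.s0 x y := by
    simp only [hx, Finset.mul_sum, ← Finset.sum_add_distrib, ← Finset.sum_sub_distrib]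
    refine Finset.sum_congr rfl fun j _ => ?_
    field_simp
    ring
  have ey : ∑ m, K.Ghat m x y * dy m K.P x y =
      - (1 / K.L x y) * (∑ m, K.Ghat m x y * dy m (fun x y => K.r00 x y * K.β x y) x y)
      + K.r00 x y * K.β x y / K.L x y ^ 2 * (∑ m, K.Ghat m x y * (2 * K.Y m x y))
      - ∑ m, K.Ghat m x y * dy m K.s0 x y := by
    simp only [hy, Finset.mul_sum, ← Finset.sum_add_distrib, ← Finset.sum_sub_distrib]
    refine Finset.sum_congr rfl fun j _ => ?_
    field_simp
    ring
  have hSL := K.spray_L h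
  rw [sprayRicci_projective K.isOpen_D K.D_cone
    (fun i => K.smoothOn_of_rationalOn (K.rationalOn_Ghat i)) hP K.homogeneousOn_Ghat
    K.homogeneousOn_P h, ex, ey, hPe x y h]
  generalize (∑ m, y m * K.Lx m x y) = A1 at *
  generalize (∑ m, K.Ghat m x y * (2 * K.Y m x y)) = A2 at *
  -- Inserting `S(L)` turns the term `-S(P)` into a further `2 β² r00² / L²`, which together with
  -- the one from `P²` makes the coefficient `3`.
  obtain rfl : A1 = 2 * A2 + (- 2 * K.L x y * K.s0 x y - 2 * K.β x y * K.r00 x y) := by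
    linarith
  field_simp
  ring

/-! ### Ricci-flatness implies that `b` is Killing -/

/-- Differentiate `b_i B^i = 1` and `b_i = a_il B^l`, then eliminate the derivatives of `B`. -/
theorem sum_B_pd_b (hx : x ∈ U) (k : Fin n) : 2 * ∑ i, K.B i x * pd k (K.b i) x =
    ∑ i, ∑ l, pd k (K.a i l) x * K.B i x * K.B l x := by
  have hB : ∀ i, HasPartial k (K.B i) x (pd k (K.B i) x) :=
    fun i => (K.smooth_B i).hasPartial K.isOpen hx k
  have hb : ∀ i, HasPartial k (K.b i) x (pd k (K.b i) x) :=
    fun i => (K.smooth_b i).hasPartial K.isOpen hx k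
  have h1 : ∑ i, (pd k (K.b i) x * K.B i x + K.b i x * pd k (K.B i) x) = 0 := by
    have e : (fun x => ∑ i, K.b i x * K.B i x) =ᶠ[nhds x] fun _ => 1 := by
      filter_upwards [K.isOpen.mem_nhds hx] with z hz using K.unit z hz
    rw [← (HasPartial.sum fun i _ => (hb i).mul (hB i)).2, e.fderiv_eq]
    exact (HasPartial.const 1).2
  have h2 : ∀ i, pd k (K.b i) x =
      ∑ l, (pd k (K.a i l) x * K.B l x + K.a i l x * pd k (K.B l) x) := fun i => by
    have e : (fun x => ∑ l, K.a i l x * K.B l x) =ᶠ[nhds x] K.b i := by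
      filter_upwards [K.isOpen.mem_nhds hx] with z hz using K.sum_a_B hz i
    rw [← (HasPartial.sum fun l _ =>
      ((K.smooth_a i l).hasPartial K.isOpen hx k).mul (hB l)).2, e.fderiv_eq]
    rfl
  have h3 : ∑ i, K.B i x * pd k (K.b i) x =
      (∑ i, ∑ l, pd k (K.a i l) x * K.B i x * K.B l x) + ∑ l, K.b l x * pd k (K.B l) x := by
    have : ∑ l, K.b l x * pd k (K.B l) x = ∑ i, ∑ l, K.a i l x * K.B i x * pd k (K.B l) x := by
      rw [Finset.sum_comm]
      refine Finset.sum_congr rfl fun l _ => ?_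
      rw [← K.sum_a_B hx l, Finset.sum_mul]
      exact Finset.sum_congr rfl fun i _ => by rw [K.symm_a i l x hx]
    rw [this]
    simp only [h2, Finset.mul_sum, ← Finset.sum_add_distrib]
    exact Finset.sum_congr rfl fun i _ => Finset.sum_congr rfl fun l _ => by ring
  rw [Finset.sum_add_distrib] at h1
  have h4 : ∑ i, pd k (K.b i) x * K.B i x = ∑ i, K.B i x * pd k (K.b i) x :=
    Finset.sum_congr rfl fun i _ => by ring
  linarith

/-- Since `b` has constant length, `b^j b_{j|k} = 0`. -/
theorem sum_B_nb (hx : x ∈ U) (k : Fin n) : ∑ j, K.B j x * K.nb j k x = 0 := by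
  have h1 : ∀ j, ∑ i, K.Γ i j k x * K.b i x = ∑ l, K.B l x * K.chr l j k x := fun j => by
    rw [← K.sum_b_raise hx fun l => K.chr l j k x]
    exact Finset.sum_congr rfl fun i _ => by rw [Γ, mul_comm]
  have h2 : ∑ j, K.B j x * ∑ l, K.B l x * K.chr l j k x =
      1 / 2 * ((∑ i, ∑ l, pd k (K.a i l) x * K.B i x * K.B l x)
        + (∑ j, ∑ l, pd j (K.a l k) x * K.B l x * K.B j x)
        - ∑ j, ∑ l, pd l (K.a j k) x * K.B l x * K.B j x) := by
    simp only [chr, Finset.mul_sum, ← Finset.sum_add_distrib, ← Finset.sum_sub_distrib]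
    refine Finset.sum_congr rfl fun j _ => Finset.sum_congr rfl fun l _ => ?_
    rw [K.pd_symm_a hx k j l]; ring
  have h3 : ∑ j, ∑ l, pd l (K.a j k) x * K.B l x * K.B j x =
      ∑ j, ∑ l, pd j (K.a l k) x * K.B l x * K.B j x := by
    rw [Finset.sum_comm]
    exact Finset.sum_congr rfl fun i _ => Finset.sum_congr rfl fun l _ => by ring
  simp only [nb, mul_sub, Finset.sum_sub_distrib, h1]
  rw [h2, h3, ← K.sum_B_pd_b hx]
  ring

/-- The dual vector field at a point. -/
def Bvec (x : EuclideanSpace ℝ (Fin n)) : EuclideanSpace ℝ (Fin n) :=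
  WithLp.toLp 2 fun i => K.B i x

theorem β_line (hx : x ∈ U) {v : EuclideanSpace ℝ (Fin n)} (hv : K.β x v = 0) (t : ℝ) :
    K.β x (t • K.Bvec x + v) = t := by
  have : K.β x (t • K.Bvec x + v) = t * (∑ i, K.b i x * K.B i x) + K.β x v := by
    simp only [β, Finset.mul_sum, ← Finset.sum_add_distrib]
    refine Finset.sum_congr rfl fun i _ => ?_
    simp [Bvec]; ring
  rw [this, K.sum_b_B hx, hv]; ring

theorem quadratic_line (c : Fin n → Fin n → ℝ) (w v : EuclideanSpace ℝ (Fin n)) (t : ℝ) :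
    ∑ i, ∑ j, c i j * (t • w + v) i * (t • w + v) j =
      (∑ i, ∑ j, c i j * v i * v j) + (∑ i, ∑ j, (c i j + c j i) * w i * v j) * t
        + (∑ i, ∑ j, c i j * w i * w j) * t ^ 2 := by
  have h : ∑ i, ∑ j, (c i j + c j i) * w i * v j =
      (∑ i, ∑ j, c i j * w i * v j) + ∑ i, ∑ j, c i j * v i * w j := by
    simp only [add_mul, Finset.sum_add_distrib]
    congr 1
    rw [Finset.sum_comm]
    exact Finset.sum_congr rfl fun i _ => Finset.sum_congr rfl fun l _ => by ring
  rw [h]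
  simp only [Finset.sum_mul, ← Finset.sum_add_distrib]
  refine Finset.sum_congr rfl fun i _ => Finset.sum_congr rfl fun l _ => ?_
  simp
  ring

/-- Pythagoras: `B` has length one for `a`, and `β(v) = 0` says that `v` is orthogonal to `B`. -/
theorem L_line (hx : x ∈ U) {v : EuclideanSpace ℝ (Fin n)} (hv : K.β x v = 0) (t : ℝ) :
    K.L x (t • K.Bvec x + v) = t ^ 2 + K.L x v := by
  have h1 : ∑ i, ∑ j, K.a i j x * K.B i x * K.B j x = 1 := by
    rw [← K.sum_b_B hx]
    refine Finset.sum_congr rfl fun i _ => ?_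
    rw [← K.sum_a_B hx i, Finset.sum_mul]
    exact Finset.sum_congr rfl fun j _ => by ring
  have h2 : ∑ i, ∑ j, (K.a i j x + K.a j i x) * K.B i x * v j = 0 := by
    have : (2 : ℝ) * K.β x v = 0 := by rw [hv, mul_zero]
    rw [← this, β, Finset.sum_comm, Finset.mul_sum]
    refine Finset.sum_congr rfl fun i _ => ?_
    rw [← K.sum_a_B hx i, Finset.sum_mul, Finset.mul_sum]
    refine Finset.sum_congr rfl fun j _ => ?_
    rw [K.symm_a j i x hx]; ring
  unfold L
  rw [quadratic_line (fun i j => K.a i j x) (K.Bvec x) v t]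
  simp only [Bvec, h1, h2]
  ring

/-- This consequence of the constant length of `b` removes the `t²` term of `r00` on the lines `t B
+ v`, which makes it affine there. -/
theorem r00_Bvec (hx : x ∈ U) : K.r00 x (K.Bvec x) = 0 := by
  rw [K.r00_eq, Finset.sum_comm]
  refine Finset.sum_eq_zero fun k _ => ?_
  have := K.sum_B_nb hx k
  calc ∑ j, K.nb j k x * K.Bvec x j * K.Bvec x k
      = (∑ j, K.B j x * K.nb j k x) * K.B k x := by
        rw [Finset.sum_mul]
        exact Finset.sum_congr rfl fun j _ => by simp only [Bvec]; ring
    _ = 0 := by rw [this, zero_mul]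

variable {F : CoordFun n}

theorem smoothOn_G (i : Fin n) : SmoothOn K.D (fun x y => K.Ghat i x y + K.P x y * y i) := by
  have hp : RationalOn U K.D K.β (fun x y => - K.r00 x y * K.β x y) :=
    K.rationalOn_r00.neg.mul K.rationalOn_β
  exact (K.smoothOn_of_rationalOn (K.rationalOn_Ghat i)).add
    ((((K.smoothOn_of_rationalOn hp).div (K.smoothOn_of_rationalOn K.rationalOn_L)
      fun x y h => (K.L_pos h).ne').sub (K.smoothOn_of_rationalOn K.rationalOn_s0)).mul
        (smoothOn_coord i))

theorem sprayRicci_eq_zero (hF : ∀ x y, (x, y) ∈ K.D → F x y = K.L x y / K.β x y)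
    (hR : ∀ x y, (x, y) ∈ K.D → ricciCurvature F x y = 0) (h : (x, y) ∈ K.D) :
    sprayRicci (fun i x y => K.Ghat i x y + K.P x y * y i) x y = 0 := by
  have hG : ∀ i x y, (x, y) ∈ K.D → geodesicCoeff F i x y = K.Ghat i x y + K.P x y * y i :=
    fun i x y h => K.geodesicCoeff_eq hF h i
  rw [← hR x y h, ricciCurvature_eq_sprayRicci K.isOpen_D
    (fun i => (K.smoothOn_G i).congr (hG i)) h]
  exact (sprayRicci_congr K.isOpen_D hG h).symm

/-- Split `y` into its part along `B` and an orthogonal part `v`. On the half-line `t B + v`, `t >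
0`, the pole identity becomes a polynomial divisibility by `t² + L(v)`, to which
`linear_eq_zero_of_dvd` applies when `v ≠ 0`. Both coefficients of the affine function `r00` vanish,
so the conclusion reaches every `y`, also outside `β > 0`. -/
theorem r00_eq_zero (hn : 2 ≤ n)
    (hR : ∀ x y, (x, y) ∈ K.D → sprayRicci (fun i x y => K.Ghat i x y + K.P x y * y i) x y = 0)
    (hx : x ∈ U) (y : EuclideanSpace ℝ (Fin n)) : K.r00 x y = 0 := by
  set v := y - K.β x y • K.Bvec x with hvdef
  have hy : y = K.β x y • K.Bvec x + v := by simp [hvdef]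
  have hv : K.β x v = 0 := by
    have h1 : K.β x v = K.β x y - K.β x y * ∑ i, K.b i x * K.B i x := by
      simp only [β, Finset.mul_sum, ← Finset.sum_sub_distrib]
      refine Finset.sum_congr rfl fun i _ => ?_
      simp [hvdef, Bvec, β]; ring
    rw [h1, K.sum_b_B hx]; ring
  by_cases hv0 : v = 0
  · rw [hy, hv0, add_zero, K.r00_smul, K.r00_Bvec hx, mul_zero]
  obtain ⟨N, hN, hRic⟩ := K.exists_sprayRicci_eq
  have hline : ∀ t : ℝ, 0 < t → (x, t • K.Bvec x + v) ∈ K.D ∧ K.β x (t • K.Bvec x + v) = t :=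
    fun t ht => by
      have := K.β_line hx hv t
      exact ⟨⟨hx, by rw [this]; exact ht⟩, this⟩
  obtain ⟨q, k, hq⟩ := hN.restrict_line hline
  have hr : ∀ t : ℝ, K.r00 x (t • K.Bvec x + v) = K.r00 x v +
      (∑ i, ∑ j, (K.r i j x + K.r j i x) * K.Bvec x i * v j) * t := fun t => by
    have h1 := K.r00_Bvec hx
    unfold r00 at h1 ⊢
    rw [quadratic_line (fun i j => K.r i j x) (K.Bvec x) v t, h1]
    ring
  have hn1 : (3 * (n - 1) : ℝ) ≠ 0 := by
    have : (2 : ℝ) ≤ n := by exact_mod_cast hn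
    have : (0 : ℝ) < 3 * (n - 1) := by linarith
    exact this.ne'
  -- The exponent is `k + 2`: `t^k` clears the denominators of `N`, and `t²` is the factor `β²` of
  -- the leading coefficient.
  have hzero := linear_eq_zero_of_dvd (c0 := K.r00 x v)
    (c1 := ∑ i, ∑ j, (K.r i j x + K.r j i x) * K.Bvec x i * v j) hn1 (K.pos x hx v hv0) (-q) (k + 2) fun t ht => by
    have h1 := hRic _ _ (hline t ht).1
    rw [hR _ _ (hline t ht).1, (hline t ht).2, K.L_line hx hv, hr] at h1
    rw [Polynomial.eval_neg, ← hq t ht]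
    change _ = (t ^ 2 + K.L x v) * _
    linear_combination (-t ^ k) * h1
  rw [hy, hr, hzero.1, hzero.2]
  ring

/-- Polarization by differentiation: the `k`-th partial derivative of the quadratic form at `e_j` is
`2 r_jk`, by symmetry of `r`. -/
theorem r_eq_zero (hr : ∀ y, K.r00 x y = 0) (j k : Fin n) : K.r j k x = 0 := by
  have h := (hasPartial_quadratic (y := EuclideanSpace.single j 1) (fun i j => K.r i j x) k).2
  have e : (fun y' : EuclideanSpace ℝ (Fin n) => ∑ i, ∑ j, K.r i j x * y' i * y' j) =
      fun _ => 0 := funext hr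
  rw [e, (HasPartial.const 0).2] at h
  have hs : K.r k j x = K.r j k x := by unfold r; ring
  simp [hs] at h
  linarith

end UnitForm

/-! ### A trace criterion for the vanishing of a skew form. -/

/-- For a positive definite `A` and a skew `S`, `tr (A S A S) = 0` only if `S = 0`. -/
theorem Matrix.PosDef.eq_zero_of_trace_skew {m : Type*} [Fintype m] [DecidableEq m]
    {A S : Matrix m m ℝ} (hA : A.PosDef) (hS : S.transpose = -S)
    (h : (A * S * (A * S)).trace = 0) : S = 0 := by
  obtain ⟨R, hR, rfl⟩ : ∃ R : Matrix m m ℝ, IsUnit R ∧ A = R.transpose * R := by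
    open scoped MatrixOrder Matrix.Norms.L2Operator in
    obtain ⟨R, hR, h⟩ := CStarAlgebra.isStrictlyPositive_iff_eq_star_mul_self.mp
      hA.isStrictlyPositive
    exact ⟨R, hR, by rw [h, Matrix.star_eq_conjTranspose, Matrix.conjTranspose_eq_transpose_of_trivial]⟩
  -- With `A = Rᵀ R`, the matrix `T = R S Rᵀ` is skew and `tr (Tᵀ T) = -tr (A S A S) = 0`. So `T =
  -- 0`, and the invertible factors cancel.
  have h1 : ((R * S * R.transpose).conjTranspose * (R * S * R.transpose)).trace = 0 := by
    rw [Matrix.conjTranspose_eq_transpose_of_trivial]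
    simp only [Matrix.transpose_mul, Matrix.transpose_transpose, hS]
    rw [← neg_eq_zero, ← Matrix.trace_neg]
    rw [← h]
    simp only [Matrix.neg_mul, Matrix.mul_neg, neg_neg, ← Matrix.mul_assoc]
    rw [Matrix.trace_mul_comm]
    simp only [← Matrix.mul_assoc]
  rw [Matrix.trace_conjTranspose_mul_self_eq_zero_iff] at h1
  lift R to (Matrix m m ℝ)ˣ using hR
  have hT : IsUnit (R : Matrix m m ℝ).transpose := by
    rw [Matrix.isUnit_transpose]
    exact R.isUnit
  have h2 : (R : Matrix m m ℝ) * S = 0 := by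
    rwa [hT.mul_left_eq_zero] at h1
  rwa [R.isUnit.mul_right_eq_zero] at h2

namespace UnitForm

open CoordFun

variable {n : ℕ} {U : Set (EuclideanSpace ℝ (Fin n))} (K : UnitForm n U)
  {x y : EuclideanSpace ℝ (Fin n)}

/-- The matrix of `su` is the product of the inverse metric, which is positive definite, and the
skew matrix of `s`. -/
theorem s_eq_zero_of_trace (hx : x ∈ U) (h : ∑ i, ∑ m, K.su i m x * K.su m i x = 0)
    (j k : Fin n) : K.s j k x = 0 := by
  set a : Matrix (Fin n) (Fin n) ℝ := Matrix.of fun i j => K.a i j x with ha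
  set ai : Matrix (Fin n) (Fin n) ℝ := Matrix.of fun i j => K.ai i j x with hai
  set S : Matrix (Fin n) (Fin n) ℝ := Matrix.of fun i j => K.s i j x with hS
  have hpos : a.PosDef := by
    refine Matrix.PosDef.of_dotProduct_mulVec_pos ?_ fun v hv => ?_
    · ext i j
      simpa [ha] using K.symm_a j i x hx
    · have := K.pos x hx (WithLp.toLp 2 v) (by simpa using hv)
      simp only [dotProduct, Matrix.mulVec, ha, Matrix.of_apply, Finset.mul_sum]
      refine this.trans_eq (Finset.sum_congr rfl fun i _ => Finset.sum_congr rfl fun j _ => ?_)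
      simp
      ring
  have hinv : a⁻¹ = ai := by
    refine Matrix.inv_eq_right_inv ?_
    ext i k
    simp [Matrix.mul_apply, ha, hai, K.mul_inv i k x hx, Matrix.one_apply]
  have hskew : S.transpose = -S := by
    ext i j
    simpa [hS] using K.s_antisymm j i x
  have : S = 0 := by
    refine (hinv ▸ hpos.inv).eq_zero_of_trace_skew hskew ?_
    rw [← h]
    simp only [Matrix.trace, Matrix.diag, Matrix.mul_apply, su, hS, hai, Matrix.of_apply]
  exact congrFun (congrFun this j) k

/-! ### The pole of the Ricci curvature along `β = 0` -/

/-- With denominator `1` the class consists of polynomials in `y`, which are smooth across `β = 0`.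
This is what permits passing to the limit there. -/
theorem smoothOn_univ {f : CoordFun n}
    (hf : RationalOn U (U ×ˢ Set.univ) (fun _ _ => 1) f) : SmoothOn (U ×ˢ Set.univ) f :=
  hf.smoothOn (fun _ hp => hp.1) (smoothOn_const 1) fun _ _ _ => one_ne_zero

theorem hasPartial_σ_right (i k : Fin n) :
    HasPartial k (fun y' => K.σ i x y') y (K.su i k x) := by
  refine (HasPartial.sum fun l _ => HasPartial.const_mul (K.ai i l x) <|
    HasPartial.sum fun j _ => (HasPartial.coord j).const_mul (K.s l j x)).congr_val ?_
  simp [su]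

theorem sum_su (hx : x ∈ U) : ∑ i, K.su i i x = 0 := by
  have h : ∑ i, K.su i i x = - ∑ i, K.su i i x := by
    simp only [su, ← Finset.sum_neg_distrib]
    conv_lhs => rw [Finset.sum_comm]
    refine Finset.sum_congr rfl fun i _ => Finset.sum_congr rfl fun l _ => ?_
    rw [K.s_antisymm i l, K.symm_ai l i x hx]; ring
  linarith

theorem sum_Y_su (hx : x ∈ U) (i : Fin n) : ∑ m, K.Y m x y * K.su m i x = - K.slow i x y := by
  refine (K.sum_Y_raise hx fun m => K.s m i x).trans ?_
  rw [slow, ← Finset.sum_neg_distrib]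
  refine Finset.sum_congr rfl fun m _ => ?_
  rw [K.s_antisymm]; ring

section Killing

variable (hr : ∀ x, x ∈ U → ∀ y, K.r00 x y = 0)
include hr

theorem nb_eq_s (hx : x ∈ U) (j k : Fin n) : K.nb j k x = K.s j k x := by
  have : K.r j k x = 0 := K.r_eq_zero (hr x hx) j k
  have h : K.nb j k x = K.r j k x + K.s j k x := by unfold r s; ring
  rw [h, this, zero_add]

/-- Unit length gives `b^j b_{j|k} = 0`, and for a Killing form the covariant derivative is its skew
part. -/
theorem sum_B_s (hx : x ∈ U) (k : Fin n) : ∑ j, K.B j x * K.s j k x = 0 := by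
  simpa only [K.nb_eq_s hr hx] using K.sum_B_nb hx k

theorem s0_eq_zero (hx : x ∈ U) : K.s0 x y = 0 := by
  have : K.s0 x y = ∑ j, (∑ l, K.B l x * K.s l j x) * y j := by
    simp only [s0, slow, Finset.mul_sum, Finset.sum_mul]
    rw [Finset.sum_comm]
    exact Finset.sum_congr rfl fun i _ => Finset.sum_congr rfl fun l _ => by ring
  simp [this, K.sum_B_s hr hx]

theorem sum_b_su (hx : x ∈ U) (i : Fin n) : ∑ m, K.b m x * K.su m i x = 0 :=
  (K.sum_b_raise hx fun m => K.s m i x).trans (K.sum_B_s hr hx i)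

theorem spray_eq (i : Fin n) (h : (x, y) ∈ K.D) : K.Ghat i x y + K.P x y * y i =
    K.Gbar i x y + -(1 / 2) * (K.L x y / K.β x y) * K.σ i x y := by
  simp only [Ghat, P, hr x h.1, K.s0_eq_zero hr h.1]
  ring

/-- The Christoffel symbols contracted with `b` are the partial derivatives of `b` minus its
covariant derivative, which here is `s`. This rewrites a term of order `β⁻²` so that it cancels in
the Ricci curvature. -/
theorem sum_b_dy_Gbar (hx : x ∈ U) (m : Fin n) :
    ∑ i, K.b i x * dy m (K.Gbar i) x y = K.βx m x y + K.slow m x y := by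
  have h1 : ∀ i, dy m (K.Gbar i) x y = ∑ j, K.Γ i j m x * y j := fun i => by
    refine ((hasPartial_quadratic (fun j k => K.Γ i j k x) m).const_mul (1 / 2)).2.trans ?_
    rw [Finset.mul_sum]
    refine Finset.sum_congr rfl fun j _ => ?_
    rw [K.Γ_symm hx i m j]; ring
  have h2 : ∑ i, K.b i x * dy m (K.Gbar i) x y = ∑ j, (∑ i, K.Γ i j m x * K.b i x) * y j := by
    simp only [h1, Finset.mul_sum, Finset.sum_mul]
    rw [Finset.sum_comm]
    exact Finset.sum_congr rfl fun i _ => Finset.sum_congr rfl fun l _ => by ring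
  rw [h2, βx, slow, ← Finset.sum_add_distrib]
  refine Finset.sum_congr rfl fun j _ => ?_
  have := K.nb_eq_s hr hx j m
  rw [K.s_antisymm, nb] at this
  linear_combination (- y j) * this

/-- The Ricci curvature has a double pole along `β = 0`, with coefficient the square of the length
of the covariant derivative of `b`. -/
theorem exists_sprayRicci_eq_of_killing : ∃ N : CoordFun n, SmoothOn (U ×ˢ Set.univ) N ∧
    ∀ x y, (x, y) ∈ K.D →
    K.β x y ^ 2 * sprayRicci (fun i x y => K.Ghat i x y + K.P x y * y i) x y =
      -(1 / 4) * K.L x y ^ 2 * (∑ i, ∑ m, K.su i m x * K.su m i x) + K.β x y * N x y := by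
  have hU : IsOpen (U ×ˢ (Set.univ : Set (EuclideanSpace ℝ (Fin n)))) :=
    K.isOpen.prod isOpen_univ
  have hG : ∀ i, SmoothOn (U ×ˢ Set.univ) (K.Gbar i) := fun i => smoothOn_univ (K.rationalOn_Gbar i)
  have hσ : ∀ i, SmoothOn (U ×ˢ Set.univ) (K.σ i) := fun i => smoothOn_univ (K.rationalOn_σ i)
  have hL : SmoothOn (U ×ˢ Set.univ) K.L := smoothOn_univ K.rationalOn_L
  have hY : ∀ i, SmoothOn (U ×ˢ Set.univ) (K.Y i) := fun i => smoothOn_univ (K.rationalOn_Y i)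
  have hdiv := SmoothOn.divY hG hU
  have hsu : ∀ i m, SmoothOn (U ×ˢ Set.univ) (fun x _ => K.su i m x) := fun i m =>
    smoothOn_coef (ContDiffOn.sum fun l _ => (K.smooth_ai i l).mul (K.smooth_s l m))
      fun _ hp => hp.1
  refine ⟨fun x y => K.β x y * sprayRicci K.Gbar x y - (∑ k, dx k K.L x y * K.σ k x y)
    - K.L x y * (∑ k, dx k (K.σ k) x y) - K.L x y * (∑ m, K.σ m x y * dy m (divY K.Gbar) x y)
    + 2 * (∑ i, ∑ m, dy m (K.Gbar i) x y * K.σ m x y * K.Y i x y)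
    + K.L x y * (∑ i, ∑ m, dy m (K.Gbar i) x y * K.su m i x), ?_, fun x y h => ?_⟩
  · refine (((((K.smoothOn_β.mul ?_).sub (SmoothOn.sum fun k _ => (hL.dx hU k).mul (hσ k))).sub
      (hL.mul (SmoothOn.sum fun k _ => (hσ k).dx hU k))).sub
      (hL.mul (SmoothOn.sum fun m _ => (hσ m).mul (hdiv.dy hU m)))).add
      ((smoothOn_const 2).mul (SmoothOn.sum fun i _ => SmoothOn.sum fun m _ =>
        (((hG i).dy hU m).mul (hσ m)).mul (hY i)))).add
      (hL.mul (SmoothOn.sum fun i _ => SmoothOn.sum fun m _ => ((hG i).dy hU m).mul (hsu m i)))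
    exact ((((smoothOn_const 2).mul (SmoothOn.sum fun k _ => (hG k).dx hU k)).sub
      (SmoothOn.sum fun m _ => (hdiv.dx hU m).mul (smoothOn_coord m))).add
      ((smoothOn_const 2).mul (SmoothOn.sum fun m _ => (hG m).mul (hdiv.dy hU m)))).sub
      (SmoothOn.sum fun i _ => SmoothOn.sum fun m _ => ((hG i).dy hU m).mul ((hG m).dy hU i))
  have hmem : ∀ x y, (x, y) ∈ K.D → (x, y) ∈ U ×ˢ (Set.univ : Set (EuclideanSpace ℝ (Fin n))) :=
    fun x y h => ⟨h.1, trivial⟩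
  have hy : ∀ x y, (x, y) ∈ K.D → ∀ i m,
      dy m (fun x y => K.Gbar i x y + -(1 / 2) * (K.L x y / K.β x y) * K.σ i x y) x y =
      dy m (K.Gbar i) x y + ((- (1 / K.β x y) * K.Y m x y +
        1 / 2 * (K.L x y / K.β x y ^ 2) * K.b m x) * K.σ i x y
        + -(1 / 2) * (K.L x y / K.β x y) * K.su i m x) := fun x y h i m => by
    have hβ := K.β_ne_zero x y h
    refine (((hG i).hasPartial_right hU (hmem x y h) m).add
      ((((K.hasPartial_L_right h.1 m).div (K.hasPartial_β_right m) hβ).const_mul (-(1 / 2))).mul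
        (K.hasPartial_σ_right i m))).2.trans ?_
    field_simp
    ring
  have hx : ∀ k,
      dx k (fun x y => K.Gbar k x y + -(1 / 2) * (K.L x y / K.β x y) * K.σ k x y) x y =
      dx k (K.Gbar k) x y + ((-(1 / 2) * (1 / K.β x y) * dx k K.L x y +
        1 / 2 * (K.L x y / K.β x y ^ 2) * K.βx k x y) * K.σ k x y
        + -(1 / 2) * (K.L x y / K.β x y) * dx k (K.σ k) x y) := fun k => by
    have hβ := K.β_ne_zero x y h
    refine (((hG k).hasPartial_left hU (hmem x y h) k).add
      ((((hL.hasPartial_left hU (hmem x y h) k).div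
        (K.hasPartial_β_left h.1 k) hβ).const_mul (-(1 / 2))).mul
        ((hσ k).hasPartial_left hU (hmem x y h) k))).2.trans ?_
    field_simp
    ring
  have hfσ : ∀ x y, (x, y) ∈ K.D → ∑ m, (- (1 / K.β x y) * K.Y m x y +
      1 / 2 * (K.L x y / K.β x y ^ 2) * K.b m x) * K.σ m x y = 0 := fun x y h => by
    have : ∑ m, (- (1 / K.β x y) * K.Y m x y +
        1 / 2 * (K.L x y / K.β x y ^ 2) * K.b m x) * K.σ m x y =
        - (1 / K.β x y) * (∑ m, K.Y m x y * K.σ m x y) +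
        1 / 2 * (K.L x y / K.β x y ^ 2) * ∑ m, K.b m x * K.σ m x y := by
      simp only [Finset.mul_sum, ← Finset.sum_add_distrib]
      exact Finset.sum_congr rfl fun i _ => by ring
    rw [this, K.sum_Y_σ h.1, K.sum_b_σ h.1, K.s0_eq_zero hr h.1]
    ring
  -- The correction `-(L / 2β) σ` is divergence free in `y`: `su` has trace zero, and `σ` is
  -- annihilated by both `Y` and `b`. The divergence terms of the Ricci curvature thus involve only
  -- `Gbar`.
  have hdivG : ∀ x y, (x, y) ∈ K.D →
      divY (fun i x y => K.Gbar i x y + -(1 / 2) * (K.L x y / K.β x y) * K.σ i x y) x y =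
      divY K.Gbar x y := fun x y h => by
    simp only [divY, hy x y h, Finset.sum_add_distrib, hfσ x y h, ← Finset.mul_sum, K.sum_su h.1]
    ring
  rw [sprayRicci_congr K.isOpen_D (fun i x y h => K.spray_eq hr i h) h]
  have hβ := K.β_ne_zero x y h
  unfold sprayRicci
  simp only [hx, fun m => dx_congr K.isOpen_D hdivG m h, fun m => dy_congr K.isOpen_D hdivG m h,
    hy x y h]
  have e1 : ∑ k, (dx k (K.Gbar k) x y + ((-(1 / 2) * (1 / K.β x y) * dx k K.L x y +
        1 / 2 * (K.L x y / K.β x y ^ 2) * K.βx k x y) * K.σ k x y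
        + -(1 / 2) * (K.L x y / K.β x y) * dx k (K.σ k) x y)) =
      (∑ k, dx k (K.Gbar k) x y) - 1 / 2 * (1 / K.β x y) * (∑ k, dx k K.L x y * K.σ k x y)
      + 1 / 2 * (K.L x y / K.β x y ^ 2) * (∑ k, K.βx k x y * K.σ k x y)
      - 1 / 2 * (K.L x y / K.β x y) * ∑ k, dx k (K.σ k) x y := by
    simp only [Finset.mul_sum, ← Finset.sum_add_distrib, ← Finset.sum_sub_distrib]
    exact Finset.sum_congr rfl fun i _ => by ring
  have e2 : ∑ m, (K.Gbar m x y + -(1 / 2) * (K.L x y / K.β x y) * K.σ m x y) *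
        dy m (divY K.Gbar) x y =
      (∑ m, K.Gbar m x y * dy m (divY K.Gbar) x y)
      - 1 / 2 * (K.L x y / K.β x y) * ∑ m, K.σ m x y * dy m (divY K.Gbar) x y := by
    simp only [Finset.mul_sum, ← Finset.sum_sub_distrib]
    exact Finset.sum_congr rfl fun i _ => by ring
  -- Expansion of the trace of the square of `g + z ⊗ p + c u`. It is used with `g = dGbar`, `z =
  -- σ`, `p` the `y`-differential of `-L / 2β`, `c = -L / 2β` and `u = su`.
  have e3 : ∀ (g : Fin n → Fin n → ℝ) (p z : Fin n → ℝ) (c : ℝ) (u : Fin n → Fin n → ℝ),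
      ∑ i, ∑ m, (g i m + (p m * z i + c * u i m)) * (g m i + (p i * z m + c * u m i)) =
      (∑ i, ∑ m, g i m * g m i) + 2 * (∑ i, ∑ m, g i m * z m * p i)
      + 2 * c * (∑ i, ∑ m, g i m * u m i) + (∑ m, p m * z m) * (∑ m, p m * z m)
      + 2 * c * (∑ i, z i * ∑ m, p m * u m i) + c ^ 2 * ∑ i, ∑ m, u i m * u m i := by
    intro g p z c u
    have c1 : ∑ i, ∑ m, g m i * z i * p m = ∑ i, ∑ m, g i m * z m * p i := Finset.sum_comm
    have c2 : ∑ i, ∑ m, g m i * u i m = ∑ i, ∑ m, g i m * u m i := Finset.sum_comm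
    have c3 : ∑ i, ∑ m, z m * p i * u i m = ∑ i, ∑ m, z i * p m * u m i := Finset.sum_comm
    have expand : ∑ i, ∑ m, (g i m + (p m * z i + c * u i m)) *
        (g m i + (p i * z m + c * u m i)) =
      (∑ i, ∑ m, g i m * g m i) + (∑ i, ∑ m, g i m * z m * p i)
      + (∑ i, ∑ m, g m i * z i * p m)
      + c * (∑ i, ∑ m, g i m * u m i) + c * (∑ i, ∑ m, g m i * u i m)
      + (∑ i, ∑ m, (p i * z i) * (p m * z m))
      + c * (∑ i, ∑ m, z i * p m * u m i) + c * (∑ i, ∑ m, z m * p i * u i m)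
      + c ^ 2 * ∑ i, ∑ m, u i m * u m i := by
      simp only [Finset.mul_sum, ← Finset.sum_add_distrib]
      exact Finset.sum_congr rfl fun i _ => Finset.sum_congr rfl fun m _ => by ring
    have c4 : ∑ i, z i * ∑ m, p m * u m i = ∑ i, ∑ m, z i * p m * u m i := by
      simp only [Finset.mul_sum]
      exact Finset.sum_congr rfl fun i _ => Finset.sum_congr rfl fun m _ => by ring
    rw [expand, c1, c2, c3, c4, Finset.sum_mul_sum]
    ring
  have e4 : ∀ i, ∑ m, (- (1 / K.β x y) * K.Y m x y +
      1 / 2 * (K.L x y / K.β x y ^ 2) * K.b m x) * K.su m i x = 1 / K.β x y * K.slow i x y :=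
      fun i => by
    have : ∑ m, (- (1 / K.β x y) * K.Y m x y +
        1 / 2 * (K.L x y / K.β x y ^ 2) * K.b m x) * K.su m i x =
        - (1 / K.β x y) * (∑ m, K.Y m x y * K.su m i x) +
        1 / 2 * (K.L x y / K.β x y ^ 2) * ∑ m, K.b m x * K.su m i x := by
      simp only [Finset.mul_sum, ← Finset.sum_add_distrib]
      exact Finset.sum_congr rfl fun i _ => by ring
    rw [this, K.sum_Y_su h.1, K.sum_b_su hr h.1]
    ring
  have e5 : ∑ i, ∑ m, dy m (K.Gbar i) x y * K.σ m x y * (- (1 / K.β x y) * K.Y i x y +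
      1 / 2 * (K.L x y / K.β x y ^ 2) * K.b i x) =
      - (1 / K.β x y) * (∑ i, ∑ m, dy m (K.Gbar i) x y * K.σ m x y * K.Y i x y)
      + 1 / 2 * (K.L x y / K.β x y ^ 2) * ((∑ k, K.βx k x y * K.σ k x y)
        + ∑ k, K.σ k x y * K.slow k x y) := by
    have e6 : (∑ k, K.βx k x y * K.σ k x y) + ∑ k, K.σ k x y * K.slow k x y =
        ∑ i, ∑ m, dy m (K.Gbar i) x y * K.σ m x y * K.b i x := by
      rw [← Finset.sum_add_distrib, Finset.sum_comm]
      refine Finset.sum_congr rfl fun m _ => ?_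
      have := K.sum_b_dy_Gbar hr h.1 (y := y) m
      calc K.βx m x y * K.σ m x y + K.σ m x y * K.slow m x y
          = (K.βx m x y + K.slow m x y) * K.σ m x y := by ring
        _ = _ := by
          rw [← this, Finset.sum_mul]
          exact Finset.sum_congr rfl fun i _ => by ring
    rw [e6]
    simp only [Finset.mul_sum, ← Finset.sum_add_distrib]
    exact Finset.sum_congr rfl fun i _ => Finset.sum_congr rfl fun m _ => by ring
  have e7 : ∑ i, K.σ i x y * (1 / K.β x y * K.slow i x y) =
      1 / K.β x y * ∑ k, K.σ k x y * K.slow k x y := by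
    rw [Finset.mul_sum]
    exact Finset.sum_congr rfl fun i _ => by ring
  -- At order `β⁻²` the terms in `βx·σ` from `e1` and `e5` cancel, and so do the terms in `σ·slow`
  -- from `e5` and `e7`. Only `-c² tr(su²)` is left.
  rw [e1, e2, e3 (fun i m => dy m (K.Gbar i) x y) (fun m => - (1 / K.β x y) * K.Y m x y +
      1 / 2 * (K.L x y / K.β x y ^ 2) * K.b m x) (fun i => K.σ i x y)
      (-(1 / 2) * (K.L x y / K.β x y)) (fun i m => K.su i m x), hfσ x y h, e5]
  simp only [e4]
  rw [e7]
  field_simp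
  ring

/-- On `t B + v` the pole identity reads `0 = -(1/4)(t² + L(v))² tr(su²) + t N` for `t > 0`. Letting
`t` tend to `0` leaves `L(v)² tr(su²) = 0` with `L(v) > 0`. -/
theorem s_eq_zero (hn : 2 ≤ n)
    (hR : ∀ x y, (x, y) ∈ K.D → sprayRicci (fun i x y => K.Ghat i x y + K.P x y * y i) x y = 0)
    (hx : x ∈ U) (j k : Fin n) : K.s j k x = 0 := by
  refine K.s_eq_zero_of_trace hx ?_ j k
  -- The kernel of `b` is nontrivial in dimension at least two: take `e_i` if `b_i = 0`, and `b_j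
  -- e_i - b_i e_j` otherwise.
  obtain ⟨v, hv0, hv⟩ : ∃ v : EuclideanSpace ℝ (Fin n), v ≠ 0 ∧ K.β x v = 0 := by
    let i : Fin n := ⟨0, by omega⟩
    let j : Fin n := ⟨1, by omega⟩
    have hij : i ≠ j := by simp [i, j]
    by_cases hb : K.b i x = 0
    · refine ⟨EuclideanSpace.single i 1, by simp, ?_⟩
      simp [β, hb]
    · refine ⟨EuclideanSpace.single i (K.b j x) - EuclideanSpace.single j (K.b i x), ?_, ?_⟩
      · intro h0
        have := congrArg (fun w : EuclideanSpace ℝ (Fin n) => w j) h0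
        simp [hij.symm] at this
        exact hb this
      · simp [β, mul_sub, Finset.sum_sub_distrib]
        ring
  obtain ⟨N, hN, hRic⟩ := K.exists_sprayRicci_eq_of_killing hr
  set S := ∑ i, ∑ m, K.su i m x * K.su m i x with hS
  let φ : ℝ → ℝ := fun t => -(1 / 4) * (t ^ 2 + K.L x v) ^ 2 * S
    + t * N x (t • K.Bvec x + v)
  have hφ0 : ∀ t : ℝ, 0 < t → φ t = 0 := fun t ht => by
    have hb := K.β_line hx hv t
    have hD : (x, t • K.Bvec x + v) ∈ K.D := ⟨hx, by rw [hb]; exact ht⟩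
    have := hRic _ _ hD
    rw [hR _ _ hD, hb, K.L_line hx hv, mul_zero] at this
    exact this.symm
  have hcont : Continuous φ := by
    have h1 : Continuous fun t : ℝ => N x (t • K.Bvec x + v) := by
      have h2 : ContinuousOn (fun p : EuclideanSpace ℝ (Fin n) × EuclideanSpace ℝ (Fin n) =>
        N p.1 p.2) (U ×ˢ Set.univ) := ContDiffOn.continuousOn hN
      exact h2.comp_continuous (f := fun t : ℝ => (x, t • K.Bvec x + v)) (by fun_prop)
        fun t => ⟨hx, trivial⟩
    exact (by fun_prop : Continuous fun t : ℝ => -(1 / 4) * (t ^ 2 + K.L x v) ^ 2 * S).add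
      (continuous_id.mul h1)
  have hlim : φ 0 = 0 := by
    refine tendsto_nhds_unique ((hcont.tendsto 0).mono_left
      (nhdsWithin_le_nhds (s := Set.Ioi 0))) (tendsto_const_nhds.congr' ?_)
    filter_upwards [self_mem_nhdsWithin] with t ht using (hφ0 t ht).symm
  have hLv : K.L x v ≠ 0 := (K.pos x hx v hv0).ne'
  simpa [φ, hLv] using hlim

end Killing

/-- A Ricci-flat Kropina metric has the geodesic coefficients of the Riemannian metric `a`. -/
theorem geodesicCoeff_eq_Gbar {F : CoordFun n} (hn : 2 ≤ n)
    (hF : ∀ x y, (x, y) ∈ K.D → F x y = K.L x y / K.β x y)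
    (hR : ∀ x y, (x, y) ∈ K.D → ricciCurvature F x y = 0) (h : (x, y) ∈ K.D) (i : Fin n) :
    geodesicCoeff F i x y = 1 / 2 * ∑ j, ∑ k, K.Γ i j k x * y j * y k := by
  have hR' : ∀ x y, (x, y) ∈ K.D →
      sprayRicci (fun i x y => K.Ghat i x y + K.P x y * y i) x y = 0 :=
    fun x y h => K.sprayRicci_eq_zero hF hR h
  have hr : ∀ x, x ∈ U → ∀ y, K.r00 x y = 0 := fun x hx y => K.r00_eq_zero hn hR' hx y
  rw [K.geodesicCoeff_eq hF h i, K.spray_eq hr i h]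
  simp [σ, slow, K.s_eq_zero hr hn hR' h.1, Gbar]

end UnitForm

/-! ### Normalization of the one-form to length one. -/

theorem contDiffOn_det {E : Type*} [NormedAddCommGroup E] [NormedSpace ℝ E] {m : Type*} [Fintype m]
    [DecidableEq m] {U : Set E} {A : E → Matrix m m ℝ}
    (h : ∀ i j, ContDiffOn ℝ ∞ (fun x => A x i j) U) : ContDiffOn ℝ ∞ (fun x => (A x).det) U := by
  simp only [Matrix.det_apply']
  exact ContDiffOn.sum fun τ _ => contDiffOn_const.mul <|
    contDiffOn_prod fun i _ => h _ _

/-- Cramer's rule: the entries of the inverse are determinants of matrices with smooth entries,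
divided by a nonvanishing determinant. -/
theorem contDiffOn_matrix_inv {E : Type*} [NormedAddCommGroup E] [NormedSpace ℝ E] {m : Type*}
    [Fintype m] [DecidableEq m] {U : Set E} {A : E → Matrix m m ℝ}
    (h : ∀ i j, ContDiffOn ℝ ∞ (fun x => A x i j) U) (h0 : ∀ x ∈ U, (A x).det ≠ 0) (i j : m) :
    ContDiffOn ℝ ∞ (fun x => (A x)⁻¹ i j) U := by
  simp only [Matrix.inv_def, Matrix.smul_apply, smul_eq_mul, Ring.inverse_eq_inv',
    Matrix.adjugate_apply]
  refine ((contDiffOn_det h).inv h0).mul (contDiffOn_det fun k l => ?_)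
  simp only [Matrix.updateRow_apply]
  split_ifs
  · exact contDiffOn_const
  · exact h k l

namespace UnitForm

variable {n : ℕ} {U : Set (EuclideanSpace ℝ (Fin n))}

section Normalization

variable (A : Fin n → Fin n → EuclideanSpace ℝ (Fin n) → ℝ) (c : Fin n → EuclideanSpace ℝ (Fin n) → ℝ)

/-- The matrix of a metric at a point. -/
def metricMatrix (x : EuclideanSpace ℝ (Fin n)) : Matrix (Fin n) (Fin n) ℝ :=
  Matrix.of fun i j => A i j x

/-- The square of the length of the one-form `c`. -/
def sqLength (x : EuclideanSpace ℝ (Fin n)) : ℝ :=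
  ∑ i, c i x * ∑ j, (metricMatrix A x)⁻¹ i j * c j x

variable {A c}

theorem posDef_metricMatrix {x : EuclideanSpace ℝ (Fin n)} (hsymm : ∀ i j, A i j x = A j i x)
    (hpos : ∀ y : EuclideanSpace ℝ (Fin n), y ≠ 0 → 0 < ∑ i, ∑ j, A i j x * y i * y j) :
    (metricMatrix A x).PosDef := by
  refine Matrix.PosDef.of_dotProduct_mulVec_pos ?_ fun v hv => ?_
  · ext i j
    simpa [metricMatrix] using hsymm j i
  · have := hpos (WithLp.toLp 2 v) (by simpa using hv)
    simp only [dotProduct, Matrix.mulVec, metricMatrix, Matrix.of_apply, Finset.mul_sum]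
    refine this.trans_eq (Finset.sum_congr rfl fun i _ => Finset.sum_congr rfl fun j _ => ?_)
    simp
    ring

theorem sqLength_pos {x : EuclideanSpace ℝ (Fin n)} (hA : (metricMatrix A x).PosDef)
    (hc : ∃ i, c i x ≠ 0) : 0 < sqLength A c x := by
  have hne : (fun i => c i x) ≠ 0 := fun h => by
    obtain ⟨i, hi⟩ := hc
    exact hi (congrFun h i)
  have := hA.inv.dotProduct_mulVec_pos hne
  simpa [dotProduct, Matrix.mulVec, sqLength] using this

/-- The conformal change of a Riemannian metric `A` and a nowhere vanishing one-form `c` which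
keeps `α²/β` and gives the one-form length one. -/
def normalize (hU : IsOpen U) (hA : ∀ i j, ContDiffOn ℝ ∞ (A i j) U)
    (hc : ∀ i, ContDiffOn ℝ ∞ (c i) U) (hsymm : ∀ i j x, x ∈ U → A i j x = A j i x)
    (hpos : ∀ x, x ∈ U → ∀ y : EuclideanSpace ℝ (Fin n), y ≠ 0 →
      0 < ∑ i, ∑ j, A i j x * y i * y j)
    (hne : ∀ x, x ∈ U → ∃ i, c i x ≠ 0) : UnitForm n U :=
  have hM : ∀ x ∈ U, (metricMatrix A x).PosDef := fun x hx =>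
    posDef_metricMatrix (fun i j => hsymm i j x hx) (hpos x hx)
  have hq : ∀ x ∈ U, 0 < sqLength A c x := fun x hx => sqLength_pos (hM x hx) (hne x hx)
  have hinv : ∀ i j, ContDiffOn ℝ ∞ (fun x => (metricMatrix A x)⁻¹ i j) U :=
    contDiffOn_matrix_inv hA fun x hx => (hM x hx).det_pos.ne'
  have hsq : ContDiffOn ℝ ∞ (sqLength A c) U :=
    ContDiffOn.sum fun i _ => (hc i).mul (ContDiffOn.sum fun j _ => (hinv i j).mul (hc j))
  -- With `λ` the inverse of the squared length of `c`, both `A` and `c` are multiplied by `λ` and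
  -- the inverse metric by `λ⁻¹`. The squared length of the form becomes `λ² λ⁻¹ λ⁻¹ = 1`.
  { a := fun i j x => (sqLength A c x)⁻¹ * A i j x
    ai := fun i j x => sqLength A c x * (metricMatrix A x)⁻¹ i j
    b := fun i x => (sqLength A c x)⁻¹ * c i x
    isOpen := hU
    smooth_a := fun i j => (hsq.inv fun x hx => (hq x hx).ne').mul (hA i j)
    smooth_ai := fun i j => hsq.mul (hinv i j)
    smooth_b := fun i => (hsq.inv fun x hx => (hq x hx).ne').mul (hc i)
    symm_a := fun i j x hx => by rw [hsymm i j x hx]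
    symm_ai := fun i j x hx => by
      have := congrFun (congrFun (hM x hx).inv.isHermitian j) i
      simp only [Matrix.conjTranspose_apply, star_trivial] at this
      rw [this]
    mul_inv := fun i k x hx => by
      have h1 := congrFun (congrFun (Matrix.mul_nonsing_inv (metricMatrix A x)
        (isUnit_iff_ne_zero.mpr (hM x hx).det_pos.ne')) i) k
      rw [Matrix.mul_apply, Matrix.one_apply] at h1
      rw [← h1]
      refine Finset.sum_congr rfl fun j _ => ?_
      have := (hq x hx).ne'
      simp only [metricMatrix, Matrix.of_apply]
      field_simp
    pos := fun x hx y hy => by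
      have h1 := mul_pos (inv_pos.mpr (hq x hx)) (hpos x hx y hy)
      refine h1.trans_eq ?_
      simp only [Finset.mul_sum]
      exact Finset.sum_congr rfl fun i _ => Finset.sum_congr rfl fun j _ => by ring
    unit := fun x hx => by
      have h0 := (hq x hx).ne'
      have h1 : ∑ i, (sqLength A c x)⁻¹ * c i x *
          ∑ j, sqLength A c x * (metricMatrix A x)⁻¹ i j * ((sqLength A c x)⁻¹ * c j x) =
          (sqLength A c x)⁻¹ * sqLength A c x := by
        conv_rhs => rw [sqLength]
        conv_rhs => rw [Finset.mul_sum]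
        simp only [Finset.mul_sum]
        refine Finset.sum_congr rfl fun i _ => Finset.sum_congr rfl fun j _ => ?_
        have h2 : (∑ i, c i x * ∑ j, (metricMatrix A x)⁻¹ i j * c j x) = sqLength A c x := rfl
        simp only [Finset.mul_sum] at h2
        rw [h2]
        field_simp
      rw [h1, inv_mul_cancel₀ h0] }

end Normalization

end UnitForm

/-! ### From the manifold to local coordinates. -/

namespace KropinaMetric

variable {n : ℕ} {M : Type*} [TopologicalSpace M]
  [ChartedSpace (EuclideanSpace ℝ (Fin n)) M] [IsManifold (𝓡 n) ∞ M] (K : KropinaMetric n M)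
  {e : OpenPartialHomeomorph M (EuclideanSpace ℝ (Fin n))}

/-- The components of the metric in a chart. -/
def metricCoeff (e : OpenPartialHomeomorph M (EuclideanSpace ℝ (Fin n))) (i j : Fin n)
    (x : EuclideanSpace ℝ (Fin n)) : ℝ :=
  K.a.inner (e.symm x) (tangentVec e x (EuclideanSpace.single i 1))
    (tangentVec e x (EuclideanSpace.single j 1))

/-- The components of the one-form in a chart. -/
def formCoeff (e : OpenPartialHomeomorph M (EuclideanSpace ℝ (Fin n))) (i : Fin n)
    (x : EuclideanSpace ℝ (Fin n)) : ℝ :=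
  K.β (e.symm x) (tangentVec e x (EuclideanSpace.single i 1))

theorem tangentVec_eq_sum (e : OpenPartialHomeomorph M (EuclideanSpace ℝ (Fin n)))
    (x y : EuclideanSpace ℝ (Fin n)) :
    tangentVec e x y = ∑ i, y i • tangentVec e x (EuclideanSpace.single i 1) := by
  have : y = ∑ k, y k • (EuclideanSpace.single k (1 : ℝ) : EuclideanSpace ℝ (Fin n)) := by
    ext i
    simp [Finset.sum_apply, Pi.single_apply]
  have h2 := map_sum (mfderiv (𝓡 n) (𝓡 n) e.symm x)
    (fun k => y k • (EuclideanSpace.single k (1 : ℝ) : EuclideanSpace ℝ (Fin n))) Finset.univ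
  unfold tangentVec
  refine (congrArg (mfderiv (𝓡 n) (𝓡 n) e.symm x) this).trans (h2.trans ?_)
  exact Finset.sum_congr rfl fun k _ => map_smul (mfderiv (𝓡 n) (𝓡 n) e.symm x) (y k) _

theorem form_tangentVec (e : OpenPartialHomeomorph M (EuclideanSpace ℝ (Fin n)))
    (x y : EuclideanSpace ℝ (Fin n)) :
    K.β (e.symm x) (tangentVec e x y) = ∑ i, K.formCoeff e i x * y i := by
  rw [tangentVec_eq_sum, map_sum]
  refine Finset.sum_congr rfl fun i _ => ?_
  rw [map_smul, smul_eq_mul, mul_comm]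
  rfl

theorem metric_tangentVec (e : OpenPartialHomeomorph M (EuclideanSpace ℝ (Fin n)))
    (x y : EuclideanSpace ℝ (Fin n)) :
    K.a.inner (e.symm x) (tangentVec e x y) (tangentVec e x y) =
      ∑ i, ∑ j, K.metricCoeff e i j x * y i * y j := by
  rw [tangentVec_eq_sum, map_sum, Finset.sum_comm]
  refine Finset.sum_congr rfl fun j _ => ?_
  rw [map_sum, sum_apply]
  refine Finset.sum_congr rfl fun i _ => ?_
  rw [map_smul, map_smul, smul_apply, smul_eq_mul, smul_eq_mul, metricCoeff]
  ring

theorem mdifferentiable_of_mem_maximalAtlas (he : e ∈ IsManifold.maximalAtlas (𝓡 n) ∞ M) :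
    e.MDifferentiable (𝓡 n) (𝓡 n) :=
  ⟨(contMDiffOn_of_mem_maximalAtlas he).mdifferentiableOn (by simp),
    (contMDiffOn_symm_of_mem_maximalAtlas he).mdifferentiableOn (by simp)⟩

/-- The coordinate field is the image of the smooth constant section `v` under the tangent map of
the inverse chart. -/
theorem contMDiffOn_tangentVec (he : e ∈ IsManifold.maximalAtlas (𝓡 n) ∞ M)
    (v : EuclideanSpace ℝ (Fin n)) :
    ContMDiffOn (𝓡 n) (𝓡 n).tangent ∞
      (fun x => (⟨e.symm x, tangentVec e x v⟩ : TangentBundle (𝓡 n) M)) e.target := by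
  have h1 := (contMDiffOn_symm_of_mem_maximalAtlas he).contMDiffOn_tangentMapWithin (m := ∞)
    (by simp) e.open_target.uniqueMDiffOn
  have h2 : ContMDiffOn (𝓡 n) (𝓡 n).tangent ∞
      (fun x => (⟨x, v⟩ : TangentBundle (𝓡 n) (EuclideanSpace ℝ (Fin n)))) e.target :=
    contMDiffOn_vectorSpace_iff_contDiffOn.mpr contDiffOn_const
  refine (h1.comp h2 fun x hx => hx).congr fun x hx => ?_
  simp only [Function.comp, tangentMapWithin, tangentVec]
  rw [mfderivWithin_of_isOpen e.open_target hx]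

/-- Pairing the smooth section `β` with a smooth coordinate field gives a smooth section of the
trivial line bundle; its fibre component is the coefficient. -/
theorem contDiffOn_formCoeff (he : e ∈ IsManifold.maximalAtlas (𝓡 n) ∞ M) (i : Fin n) :
    ContDiffOn ℝ ∞ (K.formCoeff e i) e.target := by
  rw [← contMDiffOn_iff_contDiffOn]
  intro x hx
  have h : ContMDiffWithinAt (𝓡 n) ((𝓡 n).prod 𝓘(ℝ)) ∞
      (fun x => Bundle.TotalSpace.mk' ℝ (E := Bundle.Trivial M ℝ) (e.symm x) (K.formCoeff e i x))
      e.target x := by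
    apply ContMDiffWithinAt.clm_bundle_apply (F₁ := EuclideanSpace ℝ (Fin n))
      (E₁ := fun x : M => TangentSpace (𝓡 n) x)
    · exact ContMDiffAt.comp_contMDiffWithinAt x K.contMDiff_β.contMDiffAt
        (contMDiffOn_symm_of_mem_maximalAtlas he x hx)
    · exact contMDiffOn_tangentVec he _ x hx
  simp only [Bundle.contMDiffWithinAt_totalSpace] at h
  exact h.2

theorem contDiffOn_metricCoeff (he : e ∈ IsManifold.maximalAtlas (𝓡 n) ∞ M) (i j : Fin n) :
    ContDiffOn ℝ ∞ (K.metricCoeff e i j) e.target := by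
  rw [← contMDiffOn_iff_contDiffOn]
  intro x hx
  have h : ContMDiffWithinAt (𝓡 n) ((𝓡 n).prod 𝓘(ℝ)) ∞
      (fun x => Bundle.TotalSpace.mk' ℝ (E := Bundle.Trivial M ℝ) (e.symm x)
        (K.metricCoeff e i j x)) e.target x := by
    apply ContMDiffWithinAt.clm_bundle_apply₂ (F₁ := EuclideanSpace ℝ (Fin n))
      (F₂ := EuclideanSpace ℝ (Fin n)) (E₁ := fun x : M => TangentSpace (𝓡 n) x)
      (E₂ := fun x : M => TangentSpace (𝓡 n) x)
    · exact ContMDiffAt.comp_contMDiffWithinAt x K.a.contMDiff.contMDiffAt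
        (contMDiffOn_symm_of_mem_maximalAtlas he x hx)
    · exact contMDiffOn_tangentVec he _ x hx
    · exact contMDiffOn_tangentVec he _ x hx
  simp only [Bundle.contMDiffWithinAt_totalSpace] at h
  exact h.2

theorem metricCoeff_pos (he : e ∈ IsManifold.maximalAtlas (𝓡 n) ∞ M)
    {x : EuclideanSpace ℝ (Fin n)} (hx : x ∈ e.target) {y : EuclideanSpace ℝ (Fin n)}
    (hy : y ≠ 0) : 0 < ∑ i, ∑ j, K.metricCoeff e i j x * y i * y j := by
  rw [← K.metric_tangentVec]
  refine K.a.pos _ _ fun h => hy ?_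
  have hinj : Function.Injective (mfderiv (𝓡 n) (𝓡 n) e.symm x) :=
    (mdifferentiable_of_mem_maximalAtlas he).symm.mfderiv_injective hx
  exact hinj (h.trans (map_zero (mfderiv (𝓡 n) (𝓡 n) e.symm x)).symm)

theorem exists_formCoeff_ne_zero (he : e ∈ IsManifold.maximalAtlas (𝓡 n) ∞ M)
    {x : EuclideanSpace ℝ (Fin n)} (hx : x ∈ e.target) : ∃ i, K.formCoeff e i x ≠ 0 := by
  by_contra! h
  refine K.β_ne_zero (e.symm x) (ContinuousLinearMap.ext fun w => ?_)
  obtain ⟨y, rfl⟩ : ∃ y, tangentVec e x y = w :=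
    (mdifferentiable_of_mem_maximalAtlas he).symm.mfderiv_surjective hx w
  rw [K.form_tangentVec]
  simp [h]

/-- The coordinate expression of `F`, after normalization of the one-form. -/
def unitForm (he : e ∈ IsManifold.maximalAtlas (𝓡 n) ∞ M) : UnitForm n e.target :=
  UnitForm.normalize (A := K.metricCoeff e) (c := K.formCoeff e) e.open_target
    (K.contDiffOn_metricCoeff he) (K.contDiffOn_formCoeff he)
    (fun _ _ _ _ => K.a.symm _ _ _) (fun _ hx _ hy => K.metricCoeff_pos he hx hy)
    (fun _ hx => K.exists_formCoeff_ne_zero he hx)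

theorem sqLength_pos (he : e ∈ IsManifold.maximalAtlas (𝓡 n) ∞ M) {x : EuclideanSpace ℝ (Fin n)}
    (hx : x ∈ e.target) : 0 < UnitForm.sqLength (K.metricCoeff e) (K.formCoeff e) x :=
  UnitForm.sqLength_pos (UnitForm.posDef_metricMatrix (fun _ _ => K.a.symm _ _ _)
    fun _ hy => K.metricCoeff_pos he hx hy) (K.exists_formCoeff_ne_zero he hx)

theorem unitForm_β (he : e ∈ IsManifold.maximalAtlas (𝓡 n) ∞ M) (x y : EuclideanSpace ℝ (Fin n)) :
    (K.unitForm he).β x y = (UnitForm.sqLength (K.metricCoeff e) (K.formCoeff e) x)⁻¹ *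
      K.β (e.symm x) (tangentVec e x y) := by
  rw [K.form_tangentVec, Finset.mul_sum]
  exact Finset.sum_congr rfl fun i _ => by simp only [unitForm, UnitForm.normalize]; ring

theorem unitForm_L (he : e ∈ IsManifold.maximalAtlas (𝓡 n) ∞ M) (x y : EuclideanSpace ℝ (Fin n)) :
    (K.unitForm he).L x y = (UnitForm.sqLength (K.metricCoeff e) (K.formCoeff e) x)⁻¹ *
      K.a.inner (e.symm x) (tangentVec e x y) (tangentVec e x y) := by
  rw [K.metric_tangentVec, Finset.mul_sum]
  refine Finset.sum_congr rfl fun i _ => ?_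
  rw [Finset.mul_sum]
  exact Finset.sum_congr rfl fun j _ => by simp only [unitForm, UnitForm.normalize]; ring

end KropinaMetric

theorem corollary4p1 {n : ℕ} (hn : 2 ≤ n) {M : Type*} [TopologicalSpace M]
    [ChartedSpace (EuclideanSpace ℝ (Fin n)) M] [IsManifold (𝓡 n) ∞ M]
    (K : KropinaMetric n M) (hK : ¬ K.IsRiemannian) (hflat : K.IsRicciFlat) :
    K.IsBerwald := by
  intro e he
  have hmem : ∀ x y, (x, y) ∈ (K.unitForm he).D ↔ (x, y) ∈ K.chartDomain e := fun x y =>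
    and_congr_right fun hx => by
      rw [K.unitForm_β]
      exact mul_pos_iff_of_pos_left (inv_pos.mpr (K.sqLength_pos he hx))
  -- The Christoffel symbols are those of the normalized metric, not of the given `a`.
  refine ⟨(K.unitForm he).Γ, fun x y h i => ?_⟩
  refine (K.unitForm he).geodesicCoeff_eq_Gbar hn (fun x y h => ?_) (fun x y h => ?_)
    ((hmem x y).mpr h) i
  · rw [K.unitForm_L, K.unitForm_β,
      mul_div_mul_left _ _ (inv_ne_zero (K.sqLength_pos he h.1).ne')]
    rfl
  · rw [hflat e he x y ((hmem x y).mp h), zero_mul]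

end
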